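/- For $n\in\mathbb N$ write points of the Heisenberg group $\mathbb H^n=\mathbb R^n\times\mathbb R^n\times\mathbb R$ as $(z,t)=(x,y,t)$ with $z=(x,y)\in\mathbb R^{2n}$, equip it with Lebesgue (Haar) measure $dz\,dt$, and let $\mathcal L=\sum_{j=1}^n (X_j^2+Y_j^2)$ be the sub-Laplacian, where $X_j=\partial_{x_j}+\tfrac12 y_j\partial_t$ and $Y_j=\partial_{y_j}-\tfrac12 x_j\partial_t$. For measurable functions, $\operatorname{supp} f\subset E$ means that $f=0$ almost everywhere outside $E$. A pair $(S,\Sigma)$ of measurable subsets of $\mathbb R^d$ is a weak annihilating pair if every $f\in L^2(\mathbb R^d)$ with $\operatorname{supp} f\subset S$ and $\operatorname{supp}\widehat f\subset\Sigma$ is zero. Theorem. Let $S,\Sigma\subset\mathbb R^{2n}$ be measurable sets such that $(S,T\Sigma)$ is a weak annihilating pair for every invertible linear map $T:\mathbb R^{2n}\to\mathbb R^{2n}$. Let $u\in C([0,+\infty);L^2(\mathbb H^n))$ be a solution of the free Schrödinger equation $i\partial_s u+\mathcal L u=0$ in the sense of distributions, that is, for every $\varphi\in C_c^\infty(\mathbb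 H^n)$ and every $s\ge 0$, $$\frac{d}{ds}\int_{\mathbb H^n}u(z,t,s)\varphi(z,t)\,dz\,dt=i\int_{\mathbb H^n}u(z,t,s)\,\mathcal L\varphi(z,t)\,dz\,dt$$ (one-sided derivative at $s=0$), with initial condition $u(\cdot,\cdot,0)=u_0\in L^2(\mathbb H^n)$. (This includes every solution $u\in C^1([0,+\infty);L^2(\mathbb H^n))$, and $u(\cdot,\cdot,s)=e^{is\mathcal L}u_0$ for every $u_0\in L^2(\mathbb H^n)$.) If $\operatorname{supp}u_0\subset S\times\mathbb R$ and $\operatorname{supp}u(\cdot,\cdot,s_0)\subset\Sigma\times\mathbb R$ for some $0<s_0<\infty$, then $u(\cdot,\cdot,s)=0$ for every $s\ge0$. -/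

import Mathlib

open MeasureTheory Set
open scoped FourierTransform ContDiff ENNReal

noncomputable section

/-- The space `ℝ²ⁿ` of points `z = (x, y)`, with its Euclidean norm and Lebesgue measure:
`x_j` is `z (Sum.inl j)` and `y_j` is `z (Sum.inr j)`. -/
abbrev Plane (n : ℕ) : Type := EuclideanSpace ℝ (Fin n ⊕ Fin n)

/-- The underlying manifold `ℝ²ⁿ × ℝ` of the Heisenberg group, with points `(z, t)`.
Its Haar measure is Lebesgue measure `dz dt`, which is `volume` here. -/
abbrev Heis (n : ℕ) : Type := Plane n × ℝ

/-- `L²(ℍⁿ)`, complex valued. -/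
abbrev HeisL2 (n : ℕ) : Type := Lp ℂ 2 (volume : Measure (Heis n))

/-- The left-invariant vector field `X_j = ∂/∂x_j + (y_j / 2) ∂/∂t`. -/
def heisX {n : ℕ} (j : Fin n) (φ : Heis n → ℂ) (p : Heis n) : ℂ :=
  fderiv ℝ φ p (EuclideanSpace.single (Sum.inl j) (1 : ℝ), p.1 (Sum.inr j) / 2)

/-- The left-invariant vector field `Y_j = ∂/∂y_j - (x_j / 2) ∂/∂t`. -/
def heisY {n : ℕ} (j : Fin n) (φ : Heis n → ℂ) (p : Heis n) : ℂ :=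
  fderiv ℝ φ p (EuclideanSpace.single (Sum.inr j) (1 : ℝ), -(p.1 (Sum.inl j) / 2))

/-- The sub-Laplacian `𝓛 = ∑ j, (X_j² + Y_j²)`, acting on smooth functions. -/
def subLaplacian {n : ℕ} (φ : Heis n → ℂ) (p : Heis n) : ℂ :=
  ∑ j : Fin n, (heisX j (heisX j φ) p + heisY j (heisY j φ) p)

/-- `u ∈ C([0, ∞); L²(ℍⁿ))` solves `i ∂ₛ u + 𝓛 u = 0` in the sense of distributions: for every
test function `φ`, the function `s ↦ ∫ u(s) φ` is differentiable on `[0, ∞)` (one-sidedly at `0`)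
with derivative `i ∫ u(s) 𝓛φ`. The operator `𝓛` has real coefficients and is its own transpose,
as each `X_j` and `Y_j` is divergence free. Values of `u` at negative times play no role. -/
structure IsFreeSchrodingerSolution {n : ℕ} (u : ℝ → HeisL2 n) : Prop where
  continuousOn : ContinuousOn u (Ici 0)
  weak_eq : ∀ φ : Heis n → ℂ, ContDiff ℝ ∞ φ → HasCompactSupport φ → ∀ s : ℝ, 0 ≤ s →
    HasDerivWithinAt (fun r : ℝ => ∫ p, u r p * φ p)
      (Complex.I * ∫ p, u s p * subLaplacian φ p) (Ici 0) s

/-- `(S, W)` is a weak annihilating pair: an `f ∈ L²` that vanishes almost everywhere outside `S`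
and whose Fourier transform vanishes almost everywhere outside `W` is zero. -/
def IsWeakAnnihilatingPair {ι : Type*} [Fintype ι] (S W : Set (EuclideanSpace ℝ ι)) : Prop :=
  ∀ f : Lp ℂ 2 (volume : Measure (EuclideanSpace ℝ ι)),
    (∀ᵐ x, x ∉ S → f x = 0) → (∀ᵐ ξ, ξ ∉ W → (𝓕 f) ξ = 0) → f = 0

end

/-! ### Bilinear pairings on L² -/

section L2Pairing

variable {α : Type*} [MeasurableSpace α] {μ : Measure α}

/-! Take the Fourier transform in the central variable t. At frequency ν ≠ 0, with m = 2π|ν|, the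
sub-Laplacian becomes a Hermite operator on ℝ²ⁿ combined with a rotation generator, so its
Schrödinger propagator has a Mehler kernel. When sin(mτ) ≠ 0 this kernel at time τ is a constant
times e^{iγ|z|²} e^{iγ|w|²} e^{-2πi⟨Bz,w⟩}, where γ = m cot(mτ)/4 and B is a rotation times the
scalar m/(4π sin(mτ)). Hence the slice of u(s₀) at frequency ν is, up to nonvanishing factors, the
Fourier transform of a chirp times the slice of u₀, evaluated at Bz. Chirps do not move supports:
the chirped slice lives on S and its transform on B(W), so the annihilating hypothesis with T = B
kills it. The frequencies with sin(mτ) = 0 are countable, so u₀ = 0, and uniqueness gives u = 0.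

The propagator itself is never constructed; everything is read off from pairings with coherent
states. A Gaussian of the critical width times a linear exponential keeps its form under the flow,
its parameters solving elementary ODEs (`subLaplacian_cexp_quadPhase`,
`hasDerivAt_cexp_coherentPhase`). Superposing such states over a compact set of nonzero frequencies
gives smooth square integrable solutions of the transposed equation, and their pairing with u is
conserved (`IsFreeSchrodingerSolution.pairing_eq`, where dilated cutoffs replace the compact support
that the weak formulation asks for).

The partial transform of an L² function is produced by duality (`exists_partialFourier_dual`), in a
form that keeps supports in cylinders over sets of z. Varying the frequency amplitude localises
conservation to almost every single ν, simultaneously for a countable dense set of modulations η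
(`ae_slice_pairing_eq`). At fixed ν, the Gaussian Fourier integral identifies the pairings with
those of the Mehler formula, and totality of modulated Gaussians turns this into an identity of
functions (`ae_eq_zero_of_coherent_pairing`). The same totality, used once more at an arbitrary
final time, gives uniqueness. -/

theorem memLp_conj {h : α → ℂ} (hh : MemLp h 2 μ) :
    MemLp (fun x => (starRingEnd ℂ) (h x)) 2 μ := hh.star

theorem integral_mul_eq_inner (v : Lp ℂ 2 μ) {h : α → ℂ} (hh : MemLp h 2 μ) :
    ∫ x, v x * h x ∂μ = inner ℂ (memLp_conj hh).toLp v := by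
  rw [L2.inner_def]
  refine integral_congr_ae ?_
  filter_upwards [(memLp_conj hh).coeFn_toLp] with x hx
  simp [hx, RCLike.inner_apply]

theorem continuous_integral_mul {h : α → ℂ} (hh : MemLp h 2 μ) :
    Continuous fun v : Lp ℂ 2 μ => ∫ x, v x * h x ∂μ := by
  simp_rw [integral_mul_eq_inner _ hh]
  fun_prop

theorem norm_integral_mul_le (v : Lp ℂ 2 μ) {h : α → ℂ} (hh : MemLp h 2 μ) :
    ‖∫ x, v x * h x ∂μ‖ ≤ ‖v‖ * (eLpNorm h 2 μ).toReal := by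
  rw [integral_mul_eq_inner _ hh]
  refine (norm_inner_le_norm _ _).trans_eq ?_
  rw [mul_comm, Lp.norm_toLp]
  congr 2
  exact eLpNorm_congr_norm_ae (Filter.Eventually.of_forall fun x => by simp)

theorem integrable_mul_of_memLp (v : Lp ℂ 2 μ) {h : α → ℂ} (hh : MemLp h 2 μ) :
    Integrable (fun x => v x * h x) μ :=
  MemLp.integrable_mul (Lp.memLp v) hh

end L2Pairing

/-! ### The Fourier transform on L¹ ∩ L² -/

section FourierL1L2

variable {V : Type*} [NormedAddCommGroup V] [InnerProductSpace ℝ V] [FiniteDimensional ℝ V]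
  [MeasurableSpace V] [BorelSpace V]

theorem integral_fourier_mul_eq {f g : V → ℂ} (hf : Integrable f) (hg : Integrable g) :
    ∫ x, 𝓕 f x * g x = ∫ x, f x * 𝓕 g x := by
  simpa using! (VectorFourier.integral_fourierIntegral_smul_eq_flip (L := innerₗ V)
    Real.continuous_fourierChar continuous_inner hf hg)

theorem ae_eq_zero_of_integral_schwartz {f : V → ℂ} (hf : LocallyIntegrable f)
    (h : ∀ φ : SchwartzMap V ℂ, ∫ x, φ x * f x = 0) : f =ᵐ[volume] 0 := by
  refine ae_eq_zero_of_integral_contDiff_smul_eq_zero hf fun g hg hgc => ?_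
  have h1 : HasCompactSupport (fun x => (g x : ℂ)) := hgc.comp_left (g := ((↑) : ℝ → ℂ)) (by simp)
  have h2 : ContDiff ℝ ∞ (fun x => (g x : ℂ)) := Complex.ofRealCLM.contDiff.comp hg
  simpa using h (h1.toSchwartzMap h2)

/-- Every Schwartz function is a Fourier transform, so the multiplication formula makes f orthogonal
to all of them. -/
theorem ae_eq_zero_of_fourier_eq_zero {f : V → ℂ} (hf : Integrable f)
    (h : ∀ x, 𝓕 f x = 0) : f =ᵐ[volume] 0 := by
  refine ae_eq_zero_of_integral_schwartz hf.locallyIntegrable fun φ => ?_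
  have h1 : (φ : V → ℂ) = 𝓕 ((𝓕⁻ φ : SchwartzMap V ℂ) : V → ℂ) := by
    rw [← SchwartzMap.fourier_coe, FourierTransform.fourier_fourierInv_eq]
  rw [h1, integral_fourier_mul_eq (SchwartzMap.integrable _) hf]
  simp [h]

/-- The Plancherel extension and the Fourier integral define the same tempered distribution, and
locally integrable representatives of one distribution agree almost everywhere. -/
theorem fourier_toLp_ae_eq {f : V → ℂ} (hf : Integrable f) (hf2 : MemLp f 2) :
    ((𝓕 (hf2.toLp f) : Lp ℂ 2 (volume : Measure V)) : V → ℂ) =ᵐ[volume] 𝓕 f := by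
  have hloc1 : LocallyIntegrable ((𝓕 (hf2.toLp f) : Lp ℂ 2 (volume : Measure V)) : V → ℂ) :=
    (Lp.memLp _).locallyIntegrable (by norm_num)
  have hcont : Continuous (𝓕 f) :=
    VectorFourier.fourierIntegral_continuous Real.continuous_fourierChar
      continuous_inner hf
  have hloc2 : LocallyIntegrable (𝓕 f) := hcont.locallyIntegrable
  have key := ae_eq_zero_of_integral_schwartz (hloc1.sub hloc2) fun φ => ?_
  · filter_upwards [key] with x hx
    simpa [sub_eq_zero] using hx
  have e1 := congrArg (fun T => T φ) (Lp.fourier_toTemperedDistribution_eq (hf2.toLp f))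
  simp only [TemperedDistribution.fourier_apply, Lp.toTemperedDistribution_apply] at e1
  have i1 : Integrable (fun x => φ x * (𝓕 (hf2.toLp f) : Lp ℂ 2 (volume : Measure V)) x) := by
    simp_rw [mul_comm (φ _)]
    exact integrable_mul_of_memLp _ (φ.memLp 2)
  have i2 : Integrable (fun x => φ x * 𝓕 f x) := by
    refine φ.integrable.mul_bdd (c := ∫ x, ‖f x‖) hcont.aestronglyMeasurable ?_
    exact Filter.Eventually.of_forall fun x =>
      VectorFourier.norm_fourierIntegral_le_integral_norm _ _ _ _ _
  simp only [Pi.sub_apply, mul_sub]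
  rw [integral_sub i1 i2, sub_eq_zero]
  simp only [smul_eq_mul] at e1
  rw [← e1, ← integral_fourier_mul_eq φ.integrable hf]
  refine integral_congr_ae ?_
  filter_upwards [hf2.coeFn_toLp] with x hx
  rw [hx, SchwartzMap.fourier_coe]

theorem memLp_fourier {f : V → ℂ} (hf : Integrable f) (hf2 : MemLp f 2) : MemLp (𝓕 f) 2 :=
  (memLp_congr_ae (fourier_toLp_ae_eq hf hf2)).1 (Lp.memLp _)

theorem eLpNorm_fourier {f : V → ℂ} (hf : Integrable f) (hf2 : MemLp f 2) :
    eLpNorm (𝓕 f) 2 = eLpNorm f 2 := by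
  rw [← eLpNorm_congr_ae (fourier_toLp_ae_eq hf hf2), ← Lp.enorm_def, ← eLpNorm_congr_ae hf2.coeFn_toLp,
    ← Lp.enorm_def, ← ofReal_norm, ← ofReal_norm, Lp.norm_fourier_eq]

/-- Both sides are continuous in v for the L² norm, so it suffices to check Schwartz functions,
where this is Fubini. -/
theorem integral_fourier_Lp_mul (v : Lp ℂ 2 (volume : Measure V)) {h : V → ℂ}
    (hh : Integrable h) (hh2 : MemLp h 2) :
    ∫ x, (𝓕 v : Lp ℂ 2 (volume : Measure V)) x * h x = ∫ x, v x * 𝓕 h x := by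
  refine DenseRange.induction_on
    (p := fun v : Lp ℂ 2 (volume : Measure V) =>
      ∫ x, (𝓕 v : Lp ℂ 2 (volume : Measure V)) x * h x = ∫ x, v x * 𝓕 h x)
    (SchwartzMap.denseRange_toLpCLM (p := 2) ENNReal.ofNat_ne_top) v
    (isClosed_eq ((continuous_integral_mul hh2).comp
      (Lp.fourierTransformₗᵢ V ℂ).continuous)
      (continuous_integral_mul (memLp_fourier hh hh2))) fun φ => ?_
  simp only [SchwartzMap.toLpCLM_apply, SchwartzMap.toLp_fourier_eq]
  rw [integral_congr_ae (g := fun x => 𝓕 (φ : V → ℂ) x * h x), integral_fourier_mul_eq φ.integrable hh]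
  · refine integral_congr_ae ?_
    filter_upwards [φ.coeFn_toLp 2 volume] with x hx
    rw [hx]
  · filter_upwards [(𝓕 φ : SchwartzMap V ℂ).coeFn_toLp 2 volume] with x hx
    rw [hx, SchwartzMap.fourier_coe]

end FourierL1L2

/-! ### The Fourier transform in the central variable, and its dual on L² -/

section PartialFourier

theorem eLpNorm_two_sq {α : Type*} [MeasurableSpace α] {μ : Measure α} (f : α → ℂ) :
    eLpNorm f 2 μ ^ 2 = ∫⁻ x, ‖f x‖ₑ ^ 2 ∂μ := by
  have := eLpNorm_nnreal_pow_eq_lintegral (μ := μ) (f := f) (p := 2) (by norm_num)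
  simpa using this

/-- The Fourier transform in the second variable. -/
noncomputable def partialFourier {X : Type*} (a : X × ℝ → ℂ) (p : X × ℝ) : ℂ :=
  𝓕 (fun ν => a (p.1, ν)) p.2

theorem partialFourier_congr_ae {X : Type*} [MeasureSpace X] {a b : X × ℝ → ℂ} (h : a =ᵐ[volume] b) :
    partialFourier a =ᵐ[volume] partialFourier b := by
  have h1 : ∀ᵐ z : X, (fun ν => a (z, ν)) =ᵐ[volume] fun ν => b (z, ν) :=
    Measure.ae_ae_of_ae_prod h
  have h2 := Measure.quasiMeasurePreserving_fst (μ := (volume : Measure X))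
    (ν := (volume : Measure ℝ)) |>.ae h1
  filter_upwards [h2] with p hp
  exact Real.fourier_congr_ae hp _

/-- The transform acts on the second variable only. This is what lets supports in cylinders A × ℝ
survive it. -/
theorem partialFourier_indicator {X : Type*} (A : Set X) (a : X × ℝ → ℂ) :
    partialFourier ((Prod.fst ⁻¹' A).indicator a) = (Prod.fst ⁻¹' A).indicator (partialFourier a) := by
  ext p
  unfold partialFourier
  by_cases hp : p.1 ∈ A
  · rw [indicator_of_mem (show p ∈ Prod.fst ⁻¹' A from hp)]
    refine congrArg (fun f : ℝ → ℂ => 𝓕 f p.2) ?_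
    ext ν
    exact indicator_of_mem (show (p.1, ν) ∈ Prod.fst ⁻¹' A from hp) _
  · rw [indicator_of_notMem (show p ∉ Prod.fst ⁻¹' A from hp)]
    have : (fun ν => (Prod.fst ⁻¹' A).indicator a (p.1, ν)) = fun _ => 0 := by
      ext ν
      exact indicator_of_notMem (show (p.1, ν) ∉ Prod.fst ⁻¹' A from hp) _
    rw [this, Real.fourier_real_eq]
    simp

variable {X : Type*} [MeasureSpace X] [SFinite (volume : Measure X)]

theorem MeasureTheory.MemLp.prodMk_left_ae {a : X × ℝ → ℂ} (ha : MemLp a 2) :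
    ∀ᵐ z, MemLp (fun t => a (z, t)) 2 := by
  have h1 := (memLp_two_iff_integrable_sq_norm ha.1).1 ha
  filter_upwards [ha.1.prodMk_left, h1.prod_right_ae] with z hz hz'
  exact (memLp_two_iff_integrable_sq_norm hz).2 hz'

theorem MeasureTheory.MemLp.prodMk_right_ae {a : X × ℝ → ℂ} (ha : MemLp a 2) :
    ∀ᵐ t, MemLp (fun z => a (z, t)) 2 := by
  have h1 := (memLp_two_iff_integrable_sq_norm ha.1).1 ha
  filter_upwards [ha.1.prod_swap.prodMk_left, h1.prod_left_ae] with z hz hz'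
  exact (memLp_two_iff_integrable_sq_norm hz).2 hz'

theorem aestronglyMeasurable_partialFourier {a : X × ℝ → ℂ} (ha : AEStronglyMeasurable a) :
    AEStronglyMeasurable (partialFourier a) := by
  unfold partialFourier
  simp_rw [Real.fourier_real_eq]
  refine AEStronglyMeasurable.integral_prod_right'
    (f := fun q : (X × ℝ) × ℝ => Real.fourierChar (-(q.2 * q.1.2)) • a (q.1.1, q.2)) ?_
  have hq : Measure.QuasiMeasurePreserving (fun q : (X × ℝ) × ℝ => (q.1.1, q.2))
      ((volume : Measure (X × ℝ)).prod volume) volume :=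
    (QuasiMeasurePreserving.prodMap (Measure.QuasiMeasurePreserving.id (volume : Measure X))
      (Measure.quasiMeasurePreserving_snd (μ := (volume : Measure ℝ)))).comp
      (measurePreserving_prodAssoc (volume : Measure X) (volume : Measure ℝ)
        (volume : Measure ℝ)).quasiMeasurePreserving
  have hc : Measurable fun q : (X × ℝ) × ℝ => (Real.fourierChar (-(q.2 * q.1.2)) : ℂ) :=
    (continuous_subtype_val.comp Real.continuous_fourierChar).measurable.comp (by fun_prop)
  exact hc.aestronglyMeasurable.mul (ha.comp_quasiMeasurePreserving hq)

/-- Plancherel on each slice, then Tonelli. -/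
theorem eLpNorm_partialFourier {a : X × ℝ → ℂ} (ha : MemLp a 2)
    (hi : ∀ᵐ z, Integrable fun ν => a (z, ν)) :
    eLpNorm (partialFourier a) 2 = eLpNorm a 2 := by
  have h : eLpNorm (partialFourier a) 2 ^ 2 = eLpNorm a 2 ^ 2 := by
    have h1 : ∀ f : X × ℝ → ℂ, AEStronglyMeasurable f →
        ∫⁻ p, ‖f p‖ₑ ^ 2 = ∫⁻ z, ∫⁻ t, ‖f (z, t)‖ₑ ^ 2 := fun f hf =>
      lintegral_prod _ (hf.enorm.pow_const 2)
    rw [eLpNorm_two_sq, eLpNorm_two_sq, h1 _ ha.1, h1 _ (aestronglyMeasurable_partialFourier ha.1)]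
    refine lintegral_congr_ae ?_
    filter_upwards [hi, ha.prodMk_left_ae] with z hz hz'
    have h2 := congrArg (· ^ 2) (eLpNorm_fourier hz hz')
    simp only [eLpNorm_two_sq] at h2
    exact h2
  exact (ENNReal.pow_right_strictMono two_ne_zero).injective h

theorem memLp_partialFourier {a : X × ℝ → ℂ} (ha : MemLp a 2)
    (hi : ∀ᵐ z, Integrable fun ν => a (z, ν)) : MemLp (partialFourier a) 2 :=
  ⟨aestronglyMeasurable_partialFourier ha.1, by
    rw [eLpNorm_partialFourier ha hi]; exact ha.2⟩

/-- The square integrable functions whose slices are integrable. -/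
def sliceIntegrable (X : Type*) [MeasureSpace X] :
    Submodule ℂ (Lp ℂ 2 (volume : Measure (X × ℝ))) where
  carrier := {a | ∀ᵐ z, Integrable fun ν => a (z, ν)}
  zero_mem' := by
    have := Measure.ae_ae_of_ae_prod (Lp.coeFn_zero ℂ 2 (volume : Measure (X × ℝ)))
    filter_upwards [this] with z hz
    exact (integrable_congr hz).2 (integrable_zero _ _ _)
  add_mem' {a b} ha hb := by
    have := Measure.ae_ae_of_ae_prod (Lp.coeFn_add a b)
    simp only [mem_ofPred_eq] at ha hb ⊢
    filter_upwards [this, ha, hb] with z hz h1 h2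
    exact (integrable_congr hz).2 (h1.add h2)
  smul_mem' c a ha := by
    have := Measure.ae_ae_of_ae_prod (Lp.coeFn_smul c a)
    simp only [mem_ofPred_eq] at ha ⊢
    filter_upwards [this, ha] with z hz h1
    exact (integrable_congr hz).2 (h1.smul c)

/-- U plays the role of the partial Fourier transform of u. The functional on the left is bounded on
`sliceIntegrable X` by Plancherel; Hahn–Banach extends it to L² and Riesz represents it. -/
theorem exists_partialFourier_dual (u : Lp ℂ 2 (volume : Measure (X × ℝ))) :
    ∃ U : Lp ℂ 2 (volume : Measure (X × ℝ)), ∀ a : X × ℝ → ℂ, MemLp a 2 →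
      (∀ᵐ z, Integrable fun ν => a (z, ν)) → ∫ p, u p * partialFourier a p = ∫ p, U p * a p := by
  have hmem : ∀ a : sliceIntegrable X, ∀ᵐ z, Integrable fun ν : ℝ => (a : Lp ℂ 2 (volume : Measure (X × ℝ))) (z, ν) :=
    fun a => a.2
  let f0 : sliceIntegrable X →ₗ[ℂ] ℂ :=
    { toFun := fun a => ∫ p, u p * partialFourier a p
      map_add' := fun a b => by
        rw [← integral_add (integrable_mul_of_memLp _ (memLp_partialFourier (Lp.memLp _) a.2))
          (integrable_mul_of_memLp _ (memLp_partialFourier (Lp.memLp _) b.2))]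
        refine integral_congr_ae ?_
        have h2 := Measure.quasiMeasurePreserving_fst (μ := (volume : Measure X))
          (ν := (volume : Measure ℝ)) |>.ae ((hmem a).and (hmem b))
        filter_upwards [partialFourier_congr_ae (Lp.coeFn_add a.1 b.1), h2] with p hp hp2
        rw [← mul_add]
        congr 1
        refine hp.trans ?_
        unfold partialFourier
        simp only [Real.fourier_real_eq, Pi.add_apply, smul_add]
        have hconv := fun (f : ℝ → ℂ) (hf : Integrable f) =>
          (Real.fourierIntegral_convergent_iff p.2).2 hf
        simp only [RCLike.inner_apply, conj_trivial, mul_comm p.2] at hconv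
        exact integral_add (hconv _ hp2.1) (hconv _ hp2.2)
      map_smul' := fun c a => by
        rw [RingHom.id_apply, smul_eq_mul, ← integral_const_mul]
        refine integral_congr_ae ?_
        filter_upwards [partialFourier_congr_ae (Lp.coeFn_smul c a.1)] with p hp
        rw [mul_left_comm]
        congr 1
        refine hp.trans ?_
        unfold partialFourier
        simp only [Real.fourier_real_eq, Pi.smul_apply]
        rw [← smul_eq_mul, ← integral_smul]
        simp_rw [smul_comm c] }
  let f : StrongDual ℂ (sliceIntegrable X) := f0.mkContinuous ‖u‖ fun a => by
    refine (norm_integral_mul_le u (memLp_partialFourier (Lp.memLp _) a.2)).trans_eq ?_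
    rw [eLpNorm_partialFourier (Lp.memLp _) a.2]
    rfl
  obtain ⟨g, hg, -⟩ := exists_extension_norm_eq (sliceIntegrable X) f
  -- The Riesz representer enters the inner product conjugated, whereas the pairing wanted here is
  -- bilinear; hence the conjugate.
  have hU := memLp_conj (Lp.memLp ((InnerProductSpace.toDual ℂ _).symm g))
  refine ⟨hU.toLp, fun a ha hi => ?_⟩
  have hi' : ha.toLp ∈ sliceIntegrable X := by
    have := Measure.ae_ae_of_ae_prod ha.coeFn_toLp
    filter_upwards [this, hi] with z hz h1
    exact (integrable_congr hz).2 h1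
  have h1 := hg ⟨ha.toLp, hi'⟩
  rw [← InnerProductSpace.toDual_symm_apply (𝕜 := ℂ), L2.inner_def] at h1
  have h2 : f ⟨ha.toLp, hi'⟩ = ∫ p, u p * partialFourier a p := by
    refine integral_congr_ae ?_
    filter_upwards [partialFourier_congr_ae ha.coeFn_toLp] with p hp
    exact congrArg (u p * ·) hp
  rw [← h2, ← h1]
  refine integral_congr_ae ?_
  filter_upwards [hU.coeFn_toLp, ha.coeFn_toLp] with p hp hp'
  rw [hp, hp', RCLike.inner_apply, mul_comm]

theorem exists_partialFourier_dual_of_support (u : Lp ℂ 2 (volume : Measure (X × ℝ))) {A : Set X}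
    (hA : NullMeasurableSet A volume) (hu : ∀ᵐ p : X × ℝ, p.1 ∉ A → u p = 0) :
    ∃ U : Lp ℂ 2 (volume : Measure (X × ℝ)), (∀ᵐ p : X × ℝ, p.1 ∉ A → U p = 0) ∧
      ∀ a : X × ℝ → ℂ, MemLp a 2 → (∀ᵐ z, Integrable fun ν => a (z, ν)) →
        ∫ p, u p * partialFourier a p = ∫ p, U p * a p := by
  obtain ⟨U, hU⟩ := exists_partialFourier_dual u
  -- Truncating the dual function to B × ℝ costs nothing: a truncated test function transforms to a
  -- truncated transform, and u already vanishes off A × ℝ.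
  obtain ⟨B, -, hBm, hBA⟩ := hA.exists_measurable_superset_ae_eq
  have hBA' : ∀ᵐ p : X × ℝ, p.1 ∈ B ↔ p.1 ∈ A :=
    Measure.quasiMeasurePreserving_fst (μ := (volume : Measure X))
      (ν := (volume : Measure ℝ)) |>.ae hBA.mem_iff
  have hB2 : MeasurableSet (Prod.fst ⁻¹' B : Set (X × ℝ)) := measurable_fst hBm
  have hUB := (Lp.memLp U).indicator hB2
  refine ⟨hUB.toLp, ?_, fun a ha hi => ?_⟩
  · filter_upwards [hUB.coeFn_toLp, hBA'] with p h1 h2 h3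
    rw [h1, indicator_of_notMem]
    exact fun h => h3 (h2.1 h)
  · have h1 := hU _ (ha.indicator hB2) (by
      filter_upwards [hi] with z hz
      by_cases hzB : z ∈ B
      · exact hz.congr (Filter.Eventually.of_forall fun ν => by
          exact (indicator_of_mem (show (z, ν) ∈ Prod.fst ⁻¹' B from hzB) a).symm)
      · exact (integrable_zero _ _ _).congr (Filter.Eventually.of_forall fun ν => by
          exact (indicator_of_notMem (show (z, ν) ∉ Prod.fst ⁻¹' B from hzB) a).symm))
    rw [partialFourier_indicator] at h1
    calc ∫ p, u p * partialFourier a p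
        = ∫ p, u p * (Prod.fst ⁻¹' B).indicator (partialFourier a) p := by
          refine integral_congr_ae ?_
          filter_upwards [hu, hBA'] with p h2 h3
          by_cases hp : p.1 ∈ A
          · rw [indicator_of_mem (show p ∈ Prod.fst ⁻¹' B from h3.2 hp)]
          · rw [h2 hp]; simp
      _ = ∫ p, U p * (Prod.fst ⁻¹' B).indicator a p := h1
      _ = ∫ p, (hUB.toLp : Lp ℂ 2 _) p * a p := by
          refine integral_congr_ae ?_
          filter_upwards [hUB.coeFn_toLp] with p h2
          rw [h2]
          by_cases hp : p ∈ Prod.fst ⁻¹' B <;> simp [hp]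

end PartialFourier

/-- Every smooth compactly supported function is the partial transform of an admissible a, by
slicewise Fourier inversion. -/
theorem Lp_eq_zero_of_integral_partialFourier {E : Type*} [NormedAddCommGroup E]
    [NormedSpace ℝ E] [FiniteDimensional ℝ E] [MeasureSpace E] [BorelSpace E]
    [IsLocallyFiniteMeasure (volume : Measure E)] [SFinite (volume : Measure E)]
    (u : Lp ℂ 2 (volume : Measure (E × ℝ)))
    (h : ∀ a : E × ℝ → ℂ, MemLp a 2 → (∀ᵐ z, Integrable fun ν => a (z, ν)) →
      ∫ p, u p * partialFourier a p = 0) : u = 0 := by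
  rw [Lp.eq_zero_iff_ae_eq_zero]
  have hprod : IsLocallyFiniteMeasure (volume : Measure (E × ℝ)) := by
    rw [Measure.volume_eq_prod]; infer_instance
  refine ae_eq_zero_of_integral_contDiff_smul_eq_zero
    ((Lp.memLp u).locallyIntegrable (by norm_num)) fun g hg hgc => ?_
  set G : E × ℝ → ℂ := fun p => (g p : ℂ) with hG
  have hG1 : HasCompactSupport G := hgc.comp_left (g := ((↑) : ℝ → ℂ)) (by simp)
  have hG2 : ContDiff ℝ ∞ G := Complex.ofRealCLM.contDiff.comp hg
  have hs1 : ∀ z, HasCompactSupport fun t => G (z, t) := fun z => by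
    refine HasCompactSupport.intro (hG1.isCompact.image continuous_snd) fun t ht => ?_
    by_contra h0
    exact ht ⟨(z, t), subset_tsupport _ h0, rfl⟩
  have hs2 : ∀ z, ContDiff ℝ ∞ fun t => G (z, t) := fun z => by fun_prop
  set φ : E → SchwartzMap ℝ ℂ := fun z => (hs1 z).toSchwartzMap (hs2 z) with hφ
  have hφ' : ∀ z t, φ z t = G (z, t) := fun z t => rfl
  have hGm : MemLp G 2 := hG2.continuous.memLp_of_hasCompactSupport hG1
  have hGi : ∀ᵐ z : E, Integrable fun t => G (z, t) :=
    Filter.Eventually.of_forall fun z => (φ z).integrable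
  have hb := memLp_partialFourier hGm hGi
  -- Reflecting the frequency turns the partial transform into its inverse, so measurability and
  -- square integrability of a come from those of `partialFourier G`.
  set a : E × ℝ → ℂ := fun p => partialFourier G (p.1, -p.2) with ha
  have hneg : MeasurePreserving (fun p : E × ℝ => (p.1, -p.2)) volume volume :=
    (MeasurePreserving.id (volume : Measure E)).prod (Measure.measurePreserving_neg (volume : Measure ℝ))
  have ha2 : MemLp a 2 := hb.comp_measurePreserving hneg
  have hslice : ∀ z, (fun ν => a (z, ν)) = (𝓕⁻ (φ z) : SchwartzMap ℝ ℂ) := fun z => by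
    ext ν
    simp only [ha, partialFourier]
    rw [SchwartzMap.fourierInv_coe, Real.fourierInv_eq_fourier_neg]
    rfl
  have h1 := h a ha2 (Filter.Eventually.of_forall fun z => by
    rw [hslice]; exact SchwartzMap.integrable _)
  rw [← h1]
  refine integral_congr_ae (Filter.Eventually.of_forall fun p => ?_)
  simp only [partialFourier, hslice]
  rw [← SchwartzMap.fourier_coe, FourierTransform.fourier_fourierInv_eq, hφ', hG, mul_comm]
  simp

/-! ### Smooth dependence of integrals over a compact set of frequencies -/

section ParametricIntegral

theorem integrable_slice_of_compact {P E : Type*} [TopologicalSpace P] [NormedAddCommGroup E]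
    {F : P × ℝ → E} {K : Set ℝ} (hF : Continuous F) (hK : IsCompact K)
    (h0 : ∀ p, ∀ ν ∉ K, F (p, ν) = 0) (p : P) : Integrable fun ν => F (p, ν) :=
  (hF.comp (by fun_prop : Continuous fun ν : ℝ => (p, ν))).integrable_of_hasCompactSupport
    (HasCompactSupport.intro hK (h0 p))

theorem fderiv_eq_zero_of_notMem_compact {P E : Type*} [NormedAddCommGroup P] [NormedSpace ℝ P]
    [NormedAddCommGroup E] [NormedSpace ℝ E] {F : P × ℝ → E} {K : Set ℝ} (hK : IsCompact K)
    (h0 : ∀ p, ∀ ν ∉ K, F (p, ν) = 0) (p : P) (ν : ℝ) (hν : ν ∉ K) : fderiv ℝ F (p, ν) = 0 := by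
  have h1 : F =ᶠ[nhds (p, ν)] fun _ => 0 := by
    have : (Prod.snd ⁻¹' Kᶜ : Set (P × ℝ)) ∈ nhds (p, ν) :=
      (hK.isClosed.isOpen_compl.preimage continuous_snd).mem_nhds hν
    filter_upwards [this] with q hq
    exact h0 q.1 q.2 hq
  rw [h1.fderiv_eq]
  simp

variable {P E : Type} [NormedAddCommGroup P] [NormedSpace ℝ P] [FiniteDimensional ℝ P]
  [NormedAddCommGroup E] [NormedSpace ℝ E] {F : P × ℝ → E} {K : Set ℝ}

theorem hasFDerivAt_integral_of_compact (hF : ContDiff ℝ ∞ F) (hK : IsCompact K)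
    (h0 : ∀ p, ∀ ν ∉ K, F (p, ν) = 0) (p : P) :
    HasFDerivAt (fun p => ∫ ν, F (p, ν))
      (∫ ν, (fderiv ℝ F (p, ν)).comp (ContinuousLinearMap.inl ℝ P ℝ)) p := by
  have hdF : Continuous fun q => (fderiv ℝ F q).comp (ContinuousLinearMap.inl ℝ P ℝ) :=
    (hF.continuous_fderiv (by simp)).clm_comp continuous_const
  obtain ⟨C, hC⟩ := ((isCompact_closedBall p 1).prod hK).exists_bound_of_continuousOn
    hdF.continuousOn
  refine hasFDerivAt_integral_of_dominated_of_fderiv_le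
    (F' := fun p ν => (fderiv ℝ F (p, ν)).comp (ContinuousLinearMap.inl ℝ P ℝ))
    (bound := K.indicator fun _ => C) (Metric.closedBall_mem_nhds p one_pos) ?_ ?_ ?_ ?_ ?_ ?_
  · exact Filter.Eventually.of_forall fun q =>
      (integrable_slice_of_compact hF.continuous hK h0 q).aestronglyMeasurable
  · exact integrable_slice_of_compact hF.continuous hK h0 p
  · exact (hdF.comp (by fun_prop : Continuous fun ν : ℝ => (p, ν))).aestronglyMeasurable
  · refine Filter.Eventually.of_forall fun ν q hq => ?_
    by_cases hν : ν ∈ K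
    · rw [indicator_of_mem hν]
      exact hC (q, ν) ⟨hq, hν⟩
    · rw [indicator_of_notMem hν, fderiv_eq_zero_of_notMem_compact hK h0 q ν hν]
      simp
  · exact (integrable_indicator_iff hK.measurableSet).2
      (integrableOn_const hK.measure_lt_top.ne)
  · refine Filter.Eventually.of_forall fun ν q _ => ?_
    have h1 := (hF.differentiable (by simp) (q, ν)).hasFDerivAt
    have h2 : HasFDerivAt (fun q : P => (q, ν)) (ContinuousLinearMap.inl ℝ P ℝ) q :=
      hasFDerivAt_prodMk_left q ν
    exact h1.comp q h2

/-- The derivative is again an integral of the same type with values in P →L[ℝ] E, so the induction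
has to generalise E. This is why P and E are kept in one universe. -/
theorem contDiff_integral_of_compact (hF : ContDiff ℝ ∞ F) (hK : IsCompact K)
    (h0 : ∀ p, ∀ ν ∉ K, F (p, ν) = 0) : ContDiff ℝ ∞ fun p => ∫ ν, F (p, ν) := by
  rw [contDiff_infty]
  intro n
  induction n generalizing E with
  | zero =>
    rw [Nat.cast_zero, contDiff_zero]
    exact continuous_iff_continuousAt.2 fun p =>
      (hasFDerivAt_integral_of_compact hF hK h0 p).continuousAt
  | succ n ih =>
    rw [Nat.cast_add, Nat.cast_one, contDiff_succ_iff_fderiv]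
    refine ⟨fun p => (hasFDerivAt_integral_of_compact hF hK h0 p).differentiableAt, by simp, ?_⟩
    have h1 : (fderiv ℝ fun p => ∫ ν, F (p, ν)) = fun p =>
        ∫ ν, (fderiv ℝ F (p, ν)).comp (ContinuousLinearMap.inl ℝ P ℝ) :=
      funext fun p => (hasFDerivAt_integral_of_compact hF hK h0 p).fderiv
    rw [h1]
    refine ih (F := fun q => (fderiv ℝ F q).comp (ContinuousLinearMap.inl ℝ P ℝ)) ?_ ?_
    · exact (hF.fderiv_right (m := ∞) (by simp)).clm_comp contDiff_const
    · intro p ν hν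
      rw [fderiv_eq_zero_of_notMem_compact hK h0 p ν hν]
      simp

theorem fderiv_integral_of_compact [CompleteSpace E] (hF : ContDiff ℝ ∞ F) (hK : IsCompact K)
    (h0 : ∀ p, ∀ ν ∉ K, F (p, ν) = 0) (p v : P) :
    fderiv ℝ (fun p => ∫ ν, F (p, ν)) p v = ∫ ν, fderiv ℝ (fun q => F (q, ν)) p v := by
  rw [(hasFDerivAt_integral_of_compact hF hK h0 p).fderiv, ContinuousLinearMap.integral_apply]
  · refine integral_congr_ae (Filter.Eventually.of_forall fun ν => ?_)
    have h1 := (hF.differentiable (by simp) (p, ν)).hasFDerivAt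
    have h2 : HasFDerivAt (fun q : P => (q, ν)) (ContinuousLinearMap.inl ℝ P ℝ) p :=
      hasFDerivAt_prodMk_left p ν
    have h3 := h1.comp p h2
    exact congrArg (fun T => T v) h3.fderiv.symm
  · refine integrable_slice_of_compact
      (F := fun q => (fderiv ℝ F q).comp (ContinuousLinearMap.inl ℝ P ℝ)) ?_ hK ?_ p
    · exact (hF.continuous_fderiv (by simp)).clm_comp continuous_const
    · intro p ν hν
      rw [fderiv_eq_zero_of_notMem_compact hK h0 p ν hν]
      simp

end ParametricIntegral

/-! ### The sub-Laplacian under the integral sign -/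

section VectorFields

variable {n : ℕ}

theorem contDiff_heisX {φ : Heis n → ℂ} (hφ : ContDiff ℝ ∞ φ) (j : Fin n) :
    ContDiff ℝ ∞ (heisX j φ) := by
  unfold heisX
  refine (hφ.fderiv_right (m := ∞) (by simp)).clm_apply ?_
  fun_prop

theorem contDiff_heisY {φ : Heis n → ℂ} (hφ : ContDiff ℝ ∞ φ) (j : Fin n) :
    ContDiff ℝ ∞ (heisY j φ) := by
  unfold heisY
  refine (hφ.fderiv_right (m := ∞) (by simp)).clm_apply ?_
  fun_prop

variable {F : Heis n × ℝ → ℂ} {K : Set ℝ}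

theorem heisX_integral_of_compact (hF : ContDiff ℝ ∞ F) (hK : IsCompact K)
    (h0 : ∀ p, ∀ ν ∉ K, F (p, ν) = 0) (j : Fin n) (p : Heis n) :
    heisX j (fun p => ∫ ν, F (p, ν)) p = ∫ ν, heisX j (fun q => F (q, ν)) p :=
  fderiv_integral_of_compact hF hK h0 _ _

theorem heisY_integral_of_compact (hF : ContDiff ℝ ∞ F) (hK : IsCompact K)
    (h0 : ∀ p, ∀ ν ∉ K, F (p, ν) = 0) (j : Fin n) (p : Heis n) :
    heisY j (fun p => ∫ ν, F (p, ν)) p = ∫ ν, heisY j (fun q => F (q, ν)) p :=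
  fderiv_integral_of_compact hF hK h0 _ _

theorem contDiff_fderiv_slice {G E : Type*} [NormedAddCommGroup G] [NormedSpace ℝ G]
    [NormedAddCommGroup E] [NormedSpace ℝ E] {F : G × ℝ → E}
    (hF : ContDiff ℝ ∞ F) : ContDiff ℝ ∞ fun q : G × ℝ => fderiv ℝ (fun p => F (p, q.2)) q.1 := by
  have h : (fun q : G × ℝ => fderiv ℝ (fun p => F (p, q.2)) q.1) =
      fun q => (fderiv ℝ F q).comp (ContinuousLinearMap.inl ℝ G ℝ) := by
    ext1 q
    have h1 := (hF.differentiable (by simp) (q.1, q.2)).hasFDerivAt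
    exact (h1.comp q.1 (hasFDerivAt_prodMk_left q.1 q.2)).fderiv
  rw [h]
  exact (hF.fderiv_right (m := ∞) (by simp)).clm_comp contDiff_const

theorem contDiff_heisX_slice (hF : ContDiff ℝ ∞ F) (j : Fin n) :
    ContDiff ℝ ∞ fun q : Heis n × ℝ => heisX j (fun p => F (p, q.2)) q.1 := by
  unfold heisX
  refine (contDiff_fderiv_slice hF).clm_apply ?_
  fun_prop

theorem contDiff_heisY_slice (hF : ContDiff ℝ ∞ F) (j : Fin n) :
    ContDiff ℝ ∞ fun q : Heis n × ℝ => heisY j (fun p => F (p, q.2)) q.1 := by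
  unfold heisY
  refine (contDiff_fderiv_slice hF).clm_apply ?_
  fun_prop

theorem subLaplacian_integral_of_compact (hF : ContDiff ℝ ∞ F) (hK : IsCompact K)
    (h0 : ∀ p, ∀ ν ∉ K, F (p, ν) = 0) (p : Heis n) :
    subLaplacian (fun p => ∫ ν, F (p, ν)) p = ∫ ν, subLaplacian (fun q => F (q, ν)) p := by
  have hz : ∀ ν ∉ K, (fun q => F (q, ν)) = fun _ => 0 := fun ν hν => funext fun q => h0 q ν hν
  have hX0 : ∀ (j : Fin n) (p : Heis n), ∀ ν ∉ K, heisX j (fun q => F (q, ν)) p = 0 :=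
    fun j p ν hν => by rw [hz ν hν]; simp [heisX]
  have hY0 : ∀ (j : Fin n) (p : Heis n), ∀ ν ∉ K, heisY j (fun q => F (q, ν)) p = 0 :=
    fun j p ν hν => by rw [hz ν hν]; simp [heisY]
  have hX : ∀ j : Fin n, heisX j (fun p => ∫ ν, F (p, ν)) =
      fun p => ∫ ν, heisX j (fun q => F (q, ν)) p :=
    fun j => funext fun p => heisX_integral_of_compact hF hK h0 j p
  have hY : ∀ j : Fin n, heisY j (fun p => ∫ ν, F (p, ν)) =
      fun p => ∫ ν, heisY j (fun q => F (q, ν)) p :=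
    fun j => funext fun p => heisY_integral_of_compact hF hK h0 j p
  have hXX : ∀ j : Fin n, heisX j (fun p => ∫ ν, heisX j (fun q => F (q, ν)) p) p =
      ∫ ν, heisX j (heisX j fun q => F (q, ν)) p := fun j => heisX_integral_of_compact (contDiff_heisX_slice hF j) hK (hX0 j) j p
  have hYY : ∀ j : Fin n, heisY j (fun p => ∫ ν, heisY j (fun q => F (q, ν)) p) p =
      ∫ ν, heisY j (heisY j fun q => F (q, ν)) p := fun j => heisY_integral_of_compact (contDiff_heisY_slice hF j) hK (hY0 j) j p
  have iX : ∀ j : Fin n, Integrable fun ν => heisX j (heisX j fun q => F (q, ν)) p :=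
    fun j => integrable_slice_of_compact
    (contDiff_heisX_slice (contDiff_heisX_slice hF j) j).continuous hK
    (fun q ν hν => by
      have : (fun p => heisX j (fun q => F (q, ν)) p) = fun _ => 0 := funext fun p => hX0 j p ν hν
      show heisX j (fun p => heisX j (fun q => F (q, ν)) p) q = 0
      rw [this]; simp [heisX]) p
  have iY : ∀ j : Fin n, Integrable fun ν => heisY j (heisY j fun q => F (q, ν)) p :=
    fun j => integrable_slice_of_compact
    (contDiff_heisY_slice (contDiff_heisY_slice hF j) j).continuous hK
    (fun q ν hν => by
      have : (fun p => heisY j (fun q => F (q, ν)) p) = fun _ => 0 := funext fun p => hY0 j p ν hν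
      show heisY j (fun p => heisY j (fun q => F (q, ν)) p) q = 0
      rw [this]; simp [heisY]) p
  unfold subLaplacian
  simp_rw [hX, hY]
  have hsum := integral_finsetSum (μ := (volume : Measure ℝ)) Finset.univ
    (f := fun (j : Fin n) ν => heisX j (heisX j fun q => F (q, ν)) p +
      heisY j (heisY j fun q => F (q, ν)) p) fun j _ => (iX j).add (iY j)
  rw [hsum]
  refine Finset.sum_congr rfl fun j _ => ?_
  rw [hXX, hYY]
  exact (integral_add (iX j) (iY j)).symm

end VectorFields

/-! ### Leibniz rules and homogeneity under dilations -/

section Leibniz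

variable {n : ℕ}

theorem heisX_mul {χ φ : Heis n → ℂ} (hχ : ContDiff ℝ ∞ χ) (hφ : ContDiff ℝ ∞ φ) (j : Fin n) :
    heisX j (fun p => χ p * φ p) = fun p => χ p * heisX j φ p + heisX j χ p * φ p := by
  ext p
  unfold heisX
  rw [fderiv_fun_mul (hχ.differentiable (by simp) p) (hφ.differentiable (by simp) p)]
  simp [mul_comm]

theorem heisY_mul {χ φ : Heis n → ℂ} (hχ : ContDiff ℝ ∞ χ) (hφ : ContDiff ℝ ∞ φ) (j : Fin n) :
    heisY j (fun p => χ p * φ p) = fun p => χ p * heisY j φ p + heisY j χ p * φ p := by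
  ext p
  unfold heisY
  rw [fderiv_fun_mul (hχ.differentiable (by simp) p) (hφ.differentiable (by simp) p)]
  simp [mul_comm]

theorem heisX_add {φ ψ : Heis n → ℂ} (hφ : ContDiff ℝ ∞ φ) (hψ : ContDiff ℝ ∞ ψ) (j : Fin n) :
    heisX j (fun p => φ p + ψ p) = fun p => heisX j φ p + heisX j ψ p := by
  ext p
  unfold heisX
  rw [fderiv_fun_add (hφ.differentiable (by simp) p) (hψ.differentiable (by simp) p)]
  rfl

theorem heisY_add {φ ψ : Heis n → ℂ} (hφ : ContDiff ℝ ∞ φ) (hψ : ContDiff ℝ ∞ ψ) (j : Fin n) :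
    heisY j (fun p => φ p + ψ p) = fun p => heisY j φ p + heisY j ψ p := by
  ext p
  unfold heisY
  rw [fderiv_fun_add (hφ.differentiable (by simp) p) (hψ.differentiable (by simp) p)]
  rfl

theorem subLaplacian_mul {χ φ : Heis n → ℂ} (hχ : ContDiff ℝ ∞ χ) (hφ : ContDiff ℝ ∞ φ)
    (p : Heis n) :
    subLaplacian (fun p => χ p * φ p) p = χ p * subLaplacian φ p + subLaplacian χ p * φ p +
      2 * ∑ j, (heisX j χ p * heisX j φ p + heisY j χ p * heisY j φ p) := by
  unfold subLaplacian
  rw [Finset.mul_sum, Finset.mul_sum, Finset.sum_mul, ← Finset.sum_add_distrib,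
    ← Finset.sum_add_distrib]
  refine Finset.sum_congr rfl fun j _ => ?_
  rw [heisX_mul hχ hφ, heisY_mul hχ hφ,
    heisX_add (hχ.mul (contDiff_heisX hφ j)) ((contDiff_heisX hχ j).mul hφ),
    heisY_add (hχ.mul (contDiff_heisY hφ j)) ((contDiff_heisY hχ j).mul hφ),
    heisX_mul hχ (contDiff_heisX hφ j), heisX_mul (contDiff_heisX hχ j) hφ,
    heisY_mul hχ (contDiff_heisY hφ j), heisY_mul (contDiff_heisY hχ j) hφ]
  ring

/-- The automorphic dilation `(z, t) ↦ (r z, r² t)`. -/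
noncomputable def heisDilation (n : ℕ) (r : ℝ) : Heis n →L[ℝ] Heis n :=
  (r • ContinuousLinearMap.fst ℝ (Plane n) ℝ).prod (r ^ 2 • ContinuousLinearMap.snd ℝ (Plane n) ℝ)

/-- The weight r² on t matches the coefficient of ∂/∂t, which is linear in z, so `heisX` is
homogeneous of degree one. Isotropic dilations would leave errors growing with z. -/
theorem heisX_comp_dilation {χ : Heis n → ℂ} (hχ : ContDiff ℝ ∞ χ) (r : ℝ) (j : Fin n) :
    heisX j (fun p => χ (heisDilation n r p)) = fun p => r * heisX j χ (heisDilation n r p) := by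
  ext p
  unfold heisX
  have h := ((hχ.differentiable (by simp) (heisDilation n r p)).hasFDerivAt.comp p
    (heisDilation n r).hasFDerivAt).fderiv
  have h' : fderiv ℝ (fun p => χ (heisDilation n r p)) p = _ := h
  rw [h', ContinuousLinearMap.comp_apply, ← Complex.real_smul, ← map_smul]
  congr 1
  simp [heisDilation]
  ring

theorem heisY_comp_dilation {χ : Heis n → ℂ} (hχ : ContDiff ℝ ∞ χ) (r : ℝ) (j : Fin n) :
    heisY j (fun p => χ (heisDilation n r p)) = fun p => r * heisY j χ (heisDilation n r p) := by
  ext p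
  unfold heisY
  have h := ((hχ.differentiable (by simp) (heisDilation n r p)).hasFDerivAt.comp p
    (heisDilation n r).hasFDerivAt).fderiv
  have h' : fderiv ℝ (fun p => χ (heisDilation n r p)) p = _ := h
  rw [h', ContinuousLinearMap.comp_apply, ← Complex.real_smul, ← map_smul]
  congr 1
  simp [heisDilation]
  ring

theorem heisX_const_mul {φ : Heis n → ℂ} (hφ : ContDiff ℝ ∞ φ) (c : ℂ) (j : Fin n) :
    heisX j (fun p => c * φ p) = fun p => c * heisX j φ p := by
  rw [heisX_mul contDiff_const hφ]
  simp [heisX]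

theorem heisY_const_mul {φ : Heis n → ℂ} (hφ : ContDiff ℝ ∞ φ) (c : ℂ) (j : Fin n) :
    heisY j (fun p => c * φ p) = fun p => c * heisY j φ p := by
  rw [heisY_mul contDiff_const hφ]
  simp [heisY]

theorem subLaplacian_comp_dilation {χ : Heis n → ℂ} (hχ : ContDiff ℝ ∞ χ) (r : ℝ) (p : Heis n) :
    subLaplacian (fun p => χ (heisDilation n r p)) p =
      r ^ 2 * subLaplacian χ (heisDilation n r p) := by
  unfold subLaplacian
  rw [Finset.mul_sum]
  refine Finset.sum_congr rfl fun j _ => ?_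
  rw [heisX_comp_dilation hχ, heisY_comp_dilation hχ,
    heisX_const_mul (φ := fun p => heisX j χ (heisDilation n r p))
      ((contDiff_heisX hχ j).comp (heisDilation n r).contDiff),
    heisY_const_mul (φ := fun p => heisY j χ (heisDilation n r p))
      ((contDiff_heisY hχ j).comp (heisDilation n r).contDiff)]
  have h1 := heisX_comp_dilation (contDiff_heisX hχ j) r j
  have h2 := heisY_comp_dilation (contDiff_heisY hχ j) r j
  rw [h1, h2]
  ring

end Leibniz

/-! ### Cutoffs with small horizontal derivatives -/

section Cutoff

variable {n : ℕ}

theorem hasCompactSupport_heisX {χ : Heis n → ℂ} (hχ : HasCompactSupport χ) (j : Fin n) :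
    HasCompactSupport (heisX j χ) :=
  (hχ.fderiv ℝ).mono fun p hp h => hp (by simp [heisX, h])

theorem hasCompactSupport_heisY {χ : Heis n → ℂ} (hχ : HasCompactSupport χ) (j : Fin n) :
    HasCompactSupport (heisY j χ) :=
  (hχ.fderiv ℝ).mono fun p hp h => hp (by simp [heisY, h])

/-- Smooth cutoffs adapted to the dilations of the Heisenberg group. -/
theorem exists_heis_cutoff (n : ℕ) : ∃ (χ : ℝ → Heis n → ℂ) (B : ℝ), 0 ≤ B ∧
    (∀ r, ContDiff ℝ ∞ (χ r)) ∧ (∀ r, r ≠ 0 → HasCompactSupport (χ r)) ∧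
    (∀ r p, ‖χ r p‖ ≤ 1) ∧ (∀ p, Filter.Tendsto (fun r => χ r p) (nhds 0) (nhds 1)) ∧
    ∀ r, 0 ≤ r → r ≤ 1 → ∀ p, (∀ j, ‖heisX j (χ r) p‖ ≤ r * B) ∧
      (∀ j, ‖heisY j (χ r) p‖ ≤ r * B) ∧ ‖subLaplacian (χ r) p‖ ≤ r * B := by
  obtain ⟨b⟩ : Nonempty (ContDiffBump (0 : Heis n)) := ⟨⟨1, 2, by norm_num, by norm_num⟩⟩
  set χ : Heis n → ℂ := fun p => (b p : ℂ) with hχdef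
  have hχ : ContDiff ℝ ∞ χ := Complex.ofRealCLM.contDiff.comp b.contDiff
  have hχc : HasCompactSupport χ := b.hasCompactSupport.comp_left (g := ((↑) : ℝ → ℂ)) (by simp)
  have hX : ∀ j, ∃ C, ∀ p, ‖heisX j χ p‖ ≤ C := fun j =>
    (hasCompactSupport_heisX hχc j).exists_bound_of_continuous (contDiff_heisX hχ j).continuous
  have hY : ∀ j, ∃ C, ∀ p, ‖heisY j χ p‖ ≤ C := fun j =>
    (hasCompactSupport_heisY hχc j).exists_bound_of_continuous (contDiff_heisY hχ j).continuous
  have hXX : ∀ j, ∃ C, ∀ p, ‖heisX j (heisX j χ) p‖ ≤ C := fun j =>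
    (hasCompactSupport_heisX (hasCompactSupport_heisX hχc j) j).exists_bound_of_continuous
      (contDiff_heisX (contDiff_heisX hχ j) j).continuous
  have hYY : ∀ j, ∃ C, ∀ p, ‖heisY j (heisY j χ) p‖ ≤ C := fun j =>
    (hasCompactSupport_heisY (hasCompactSupport_heisY hχc j) j).exists_bound_of_continuous
      (contDiff_heisY (contDiff_heisY hχ j) j).continuous
  choose CX hCX using hX
  choose CY hCY using hY
  choose CXX hCXX using hXX
  choose CYY hCYY using hYY
  have pX : ∀ j, 0 ≤ CX j := fun j => (norm_nonneg _).trans (hCX j 0)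
  have pY : ∀ j, 0 ≤ CY j := fun j => (norm_nonneg _).trans (hCY j 0)
  have pXX : ∀ j, 0 ≤ CXX j := fun j => (norm_nonneg _).trans (hCXX j 0)
  have pYY : ∀ j, 0 ≤ CYY j := fun j => (norm_nonneg _).trans (hCYY j 0)
  set B := ∑ j, (CX j + CY j + (CXX j + CYY j)) with hB
  have hterm : ∀ j, CX j + CY j + (CXX j + CYY j) ≤ B := fun j =>
    Finset.single_le_sum (f := fun j => CX j + CY j + (CXX j + CYY j))
      (fun i _ => by have := pX i; have := pY i; have := pXX i; have := pYY i; positivity)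
      (Finset.mem_univ j)
  have hB0 : 0 ≤ B := Finset.sum_nonneg fun i _ => by
    have := pX i; have := pY i; have := pXX i; have := pYY i; positivity
  refine ⟨fun r p => χ (heisDilation n r p), B, hB0, fun r => hχ.comp (heisDilation n r).contDiff,
    fun r hr => ?_, fun r p => ?_, fun p => ?_, fun r h0 h1 p => ⟨fun j => ?_, fun j => ?_, ?_⟩⟩
  · have hinv : Function.LeftInverse (heisDilation n r⁻¹) (heisDilation n r) := fun p => by
      ext <;> simp [heisDilation, hr]
    refine hχc.comp_isClosedEmbedding (g := heisDilation n r) ?_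
    exact hinv.isClosedEmbedding (heisDilation n r⁻¹).continuous (heisDilation n r).continuous
  · rw [hχdef, Complex.norm_real, Real.norm_of_nonneg b.nonneg]
    exact b.le_one
  · have hc : Continuous fun r => χ (heisDilation n r p) := by
      refine hχ.continuous.comp ?_
      simp only [heisDilation, ContinuousLinearMap.prod_apply, smul_apply]
      fun_prop
    have h1 : χ (heisDilation n 0 p) = 1 := by
      have : heisDilation n 0 p = 0 := by simp [heisDilation]
      rw [this, hχdef]
      simpa using b.one_of_mem_closedBall (x := 0) (by simpa using b.rIn_pos.le)
    have := hc.tendsto 0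
    rwa [h1] at this
  · rw [heisX_comp_dilation hχ, norm_mul, Complex.norm_real, Real.norm_of_nonneg h0]
    refine mul_le_mul_of_nonneg_left ((hCX j _).trans ?_) h0
    linarith [hterm j, pY j, pXX j, pYY j]
  · rw [heisY_comp_dilation hχ, norm_mul, Complex.norm_real, Real.norm_of_nonneg h0]
    refine mul_le_mul_of_nonneg_left ((hCY j _).trans ?_) h0
    linarith [hterm j, pX j, pXX j, pYY j]
  · rw [subLaplacian_comp_dilation hχ, norm_mul, norm_pow, Complex.norm_real,
      Real.norm_of_nonneg h0]
    have h2 : ‖subLaplacian χ (heisDilation n r p)‖ ≤ B :=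
      (norm_sum_le _ _).trans (Finset.sum_le_sum fun j _ => (norm_add_le _ _).trans (by
        linarith [pX j, pY j, hCXX j (heisDilation n r p), hCYY j (heisDilation n r p)]))
    calc r ^ 2 * ‖subLaplacian χ (heisDilation n r p)‖ ≤ r * B := by
          -- The second-order term is even of size r²; for r ≤ 1 it is weakened so that one factor r
          -- serves all three bounds.
          have : r ^ 2 ≤ r := by nlinarith
          gcongr
      _ = _ := rfl

end Cutoff

/-! ### Conservation of pairings with solutions of the transposed equation -/

section Evolution

variable {n : ℕ}

theorem integral_sub_mul {α : Type*} [MeasurableSpace α] {μ : Measure α} (v w : Lp ℂ 2 μ)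
    {h : α → ℂ} (hh : MemLp h 2 μ) :
    ∫ x, (v - w) x * h x ∂μ = ∫ x, v x * h x ∂μ - ∫ x, w x * h x ∂μ := by
  rw [integral_mul_eq_inner _ hh, integral_mul_eq_inner _ hh, integral_mul_eq_inner _ hh,
    inner_sub_right]

theorem hasDerivAt_param {P E : Type*} [NormedAddCommGroup P] [NormedSpace ℝ P]
    [NormedAddCommGroup E] [NormedSpace ℝ E] {G : P × ℝ → E} (hG : ContDiff ℝ ∞ G) (p : P) (r : ℝ) :
    HasDerivAt (fun r => G (p, r)) (fderiv ℝ G (p, r) (0, 1)) r := by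
  have h1 := (hG.differentiable (by simp) (p, r)).hasFDerivAt
  exact h1.comp_hasDerivAt r ((hasDerivAt_const r p).prodMk (hasDerivAt_id r))

theorem exists_bound_deriv_param {G : Heis n × ℝ → ℂ} (hG : ContDiff ℝ ∞ G)
    {K : Set (Heis n)} (hK : IsCompact K) (h0 : ∀ s, ∀ p ∉ K, G (p, s) = 0) (s : ℝ) :
    ∃ C, 0 ≤ C ∧ ∀ r ∈ Metric.closedBall s 1, ∀ p,
      ‖fderiv ℝ G (p, r) (0, 1)‖ ≤ K.indicator (fun _ => C) p := by
  have hc : Continuous fun q : Heis n × ℝ => fderiv ℝ G q (0, 1) :=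
    (hG.continuous_fderiv (by simp)).clm_apply continuous_const
  obtain ⟨C, hC⟩ := (hK.prod (isCompact_closedBall s 1)).exists_bound_of_continuousOn
    hc.continuousOn
  refine ⟨max C 0, le_max_right _ _, fun r hr p => ?_⟩
  by_cases hp : p ∈ K
  · rw [indicator_of_mem hp]
    exact (hC (p, r) ⟨hp, hr⟩).trans (le_max_left _ _)
  · rw [indicator_of_notMem hp, ← (hasDerivAt_param hG p r).deriv]
    simp [h0 _ p hp]

theorem hasDerivAt_integral_mul_param {G : Heis n × ℝ → ℂ} (hG : ContDiff ℝ ∞ G)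
    {K : Set (Heis n)} (hK : IsCompact K) (h0 : ∀ s, ∀ p ∉ K, G (p, s) = 0)
    (v : HeisL2 n) (s : ℝ) :
    HasDerivAt (fun r => ∫ p, v p * G (p, r)) (∫ p, v p * deriv (fun r => G (p, r)) s) s := by
  obtain ⟨C, hC0, hC⟩ := exists_bound_deriv_param hG hK h0 s
  have hGc : ∀ r, Continuous fun p => G (p, r) := fun r => by have := hG.continuous; fun_prop
  have hc : Continuous fun p : Heis n => fderiv ℝ G (p, s) (0, 1) :=
    ((hG.continuous_fderiv (by simp)).comp (by fun_prop : Continuous fun p : Heis n => (p, s))).clm_apply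
      continuous_const
  have hind : MemLp (K.indicator fun _ => (C : ℂ)) 2 (volume : Measure (Heis n)) :=
    memLp_indicator_const 2 hK.measurableSet _ (Or.inr hK.measure_lt_top.ne)
  simp_rw [fun p => (hasDerivAt_param hG p s).deriv]
  refine (hasDerivAt_integral_of_dominated_loc_of_deriv_le (𝕜 := ℝ)
    (F := fun r p => v p * G (p, r)) (F' := fun r p => v p * fderiv ℝ G (p, r) (0, 1))
    (bound := fun p => ‖v p * K.indicator (fun _ => (C : ℂ)) p‖)
    (Metric.closedBall_mem_nhds s one_pos) ?_ ?_ ?_ ?_ ?_ ?_).2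
  · exact Filter.Eventually.of_forall fun r =>
      (Lp.aestronglyMeasurable v).mul (hGc r).aestronglyMeasurable
  · exact integrable_mul_of_memLp v ((hGc s).memLp_of_hasCompactSupport
      (HasCompactSupport.intro hK (h0 s)))
  · exact (Lp.aestronglyMeasurable v).mul hc.aestronglyMeasurable
  · refine Filter.Eventually.of_forall fun p r hr => ?_
    rw [norm_mul, norm_mul]
    refine mul_le_mul_of_nonneg_left ((hC r hr p).trans_eq ?_) (norm_nonneg _)
    by_cases hp : p ∈ K <;> simp [hp, abs_of_nonneg hC0]
  · exact (integrable_mul_of_memLp v hind).norm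
  · exact Filter.Eventually.of_forall fun p r _ => (hasDerivAt_param hG p r).const_mul (v p)

theorem exists_lipschitz_param {G : Heis n × ℝ → ℂ} (hG : ContDiff ℝ ∞ G)
    {K : Set (Heis n)} (hK : IsCompact K) (h0 : ∀ s, ∀ p ∉ K, G (p, s) = 0) (s : ℝ) :
    ∃ C, 0 ≤ C ∧ ∀ r ∈ Metric.closedBall s 1, ∀ p,
      ‖G (p, r) - G (p, s)‖ ≤ C * |r - s| := by
  obtain ⟨C, hC0, hC⟩ := exists_bound_deriv_param hG hK h0 s
  refine ⟨C, hC0, fun r hr p => ?_⟩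
  refine (convex_closedBall s 1).norm_image_sub_le_of_norm_hasDerivWithin_le (𝕜 := ℝ)
    (f := fun r => G (p, r)) (fun x _ => (hasDerivAt_param hG p x).hasDerivWithinAt)
    (fun x hx => (hC x hx p).trans ?_) (Metric.mem_closedBall_self zero_le_one) hr
  exact indicator_le_self' (fun _ _ => hC0) p

/-- A product rule that differentiates u only weakly. Write u(r)G(r) = u(r)G(s) + u(s)G(r) + (u(r) -
u(s))(G(r) - G(s)) - u(s)G(s). The first two terms have known derivatives, the last is constant, and
the cross term is o(1) · O(|r - s|) because u is continuous in L² and G is Lipschitz in time. -/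
theorem IsFreeSchrodingerSolution.hasDerivWithinAt_pairing {u : ℝ → HeisL2 n}
    (hu : IsFreeSchrodingerSolution u) {G : Heis n × ℝ → ℂ} (hG : ContDiff ℝ ∞ G)
    {K : Set (Heis n)} (hK : IsCompact K) (h0 : ∀ s, ∀ p ∉ K, G (p, s) = 0)
    (s : ℝ) (hs : 0 ≤ s) :
    HasDerivWithinAt (fun r => ∫ p, u r p * G (p, r))
      (Complex.I * (∫ p, u s p * subLaplacian (fun q => G (q, s)) p) +
        ∫ p, u s p * deriv (fun r => G (p, r)) s) (Ici 0) s := by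
  have hGs : ∀ r, ContDiff ℝ ∞ fun p => G (p, r) := fun r => by fun_prop
  have hGc : ∀ r, HasCompactSupport fun p => G (p, r) := fun r =>
    HasCompactSupport.intro hK (h0 r)
  have hGm : ∀ r, MemLp (fun p => G (p, r)) 2 := fun r =>
    (hGs r).continuous.memLp_of_hasCompactSupport (hGc r)
  have hGd : ∀ r, MemLp (fun p => G (p, r) - G (p, s)) 2 := fun r => (hGm r).sub (hGm s)
  obtain ⟨C, hC0, hC⟩ := exists_lipschitz_param hG hK h0 s
  have hA := hu.weak_eq _ (hGs s) (hGc s) s hs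
  have hB := (hasDerivAt_integral_mul_param hG hK h0 (u s) s).hasDerivWithinAt (s := Ici 0)
  set D := C * (volume K ^ (1 / (2 : ℝ≥0∞).toReal)).toReal with hD
  have hnorm : ∀ r ∈ Metric.closedBall s 1,
      (eLpNorm (fun p => G (p, r) - G (p, s)) 2).toReal ≤ D * |r - s| := fun r hr => by
    have h1 : eLpNorm (fun p => G (p, r) - G (p, s)) 2 ≤
        eLpNorm (K.indicator fun _ => C * |r - s|) 2 := by
      refine eLpNorm_mono_real fun p => ?_
      by_cases hp : p ∈ K
      · rw [indicator_of_mem hp]; exact hC r hr p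
      · rw [indicator_of_notMem hp, h0 r p hp, h0 s p hp]; simp
    rw [eLpNorm_indicator_const hK.measurableSet (by norm_num) (by norm_num)] at h1
    have hfin : volume K ^ (1 / (2 : ℝ≥0∞).toReal) ≠ ⊤ :=
      ENNReal.rpow_ne_top_of_nonneg (by norm_num) hK.measure_lt_top.ne
    refine (ENNReal.toReal_mono (ENNReal.mul_ne_top enorm_ne_top hfin) h1).trans_eq ?_
    rw [ENNReal.toReal_mul, toReal_enorm, Real.norm_of_nonneg (by positivity), hD]
    ring
  have hE : HasDerivWithinAt (fun r => ∫ p, (u r - u s) p * (G (p, r) - G (p, s))) 0 (Ici 0) s := by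
    rw [hasDerivWithinAt_iff_isLittleO]
    simp only [sub_self, mul_zero, smul_zero, sub_zero, integral_zero]
    have hcont : Filter.Tendsto (fun r => ‖u r - u s‖) (nhdsWithin s (Ici 0)) (nhds 0) := by
      have := ((hu.continuousOn s hs).sub_const (u s)).norm
      simpa using this
    have h1 : (fun r => ‖u r - u s‖ * (D * |r - s|)) =o[nhdsWithin s (Ici 0)] fun r => r - s := by
      have h2 : (fun r => ‖u r - u s‖) =o[nhdsWithin s (Ici 0)] fun _ => (1 : ℝ) :=
        (Asymptotics.isLittleO_one_iff ℝ).2 hcont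
      have h3 : (fun r => D * |r - s|) =O[nhdsWithin s (Ici 0)] fun r => r - s :=
        (Asymptotics.isBigO_refl _ _).abs_left.const_mul_left D
      simpa using h2.mul_isBigO h3
    refine Asymptotics.IsBigO.trans_isLittleO ?_ h1
    refine Asymptotics.IsBigO.of_bound 1 ?_
    filter_upwards [mem_nhdsWithin_of_mem_nhds (Metric.closedBall_mem_nhds s one_pos)] with r hr
    refine (norm_integral_mul_le _ (hGd r)).trans ?_
    rw [one_mul, Real.norm_of_nonneg (by positivity)]
    exact mul_le_mul_of_nonneg_left (hnorm r hr) (norm_nonneg _)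
  have hsum := (hA.add hB).add hE
  rw [add_zero] at hsum
  have hconst := hsum.sub_const (∫ p, u s p * G (p, s))
  refine hconst.congr_of_mem (fun r _ => ?_) hs
  simp only [Pi.add_apply]
  rw [integral_sub_mul _ _ (hGd r)]
  have e : ∀ v : HeisL2 n, ∫ p, v p * (G (p, r) - G (p, s)) =
      (∫ p, v p * G (p, r)) - ∫ p, v p * G (p, s) := fun v => by
    simp_rw [mul_sub]
    exact integral_sub (integrable_mul_of_memLp v (hGm r)) (integrable_mul_of_memLp v (hGm s))
  rw [e, e]
  ring

/-- The pairing is bilinear and 𝓛 is its own transpose, so ψ has to solve ∂ₛψ = -i𝓛ψ for the two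
contributions to the derivative to cancel. Since ψ need not have compact support, it is multiplied
by the cutoff `χ r`. The error is the commutator of 𝓛 with the cutoff, which is O(r) in L² thanks to
the uniform bounds on ψ and its horizontal derivatives, and r → 0. -/
theorem IsFreeSchrodingerSolution.pairing_eq {u : ℝ → HeisL2 n}
    (hu : IsFreeSchrodingerSolution u) {ψ : Heis n × ℝ → ℂ} (hψ : ContDiff ℝ ∞ ψ)
    (hpde : ∀ p s, deriv (fun r => ψ (p, r)) s =
      -Complex.I * subLaplacian (fun q => ψ (q, s)) p) {τ : ℝ} (hτ : 0 ≤ τ) {M : ℝ≥0∞}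
    (hM : M ≠ ⊤) (hM0 : ∀ s ∈ Icc 0 τ, eLpNorm (fun p => ψ (p, s)) 2 ≤ M)
    (hMX : ∀ s ∈ Icc 0 τ, ∀ j, eLpNorm (heisX j fun p => ψ (p, s)) 2 ≤ M)
    (hMY : ∀ s ∈ Icc 0 τ, ∀ j, eLpNorm (heisY j fun p => ψ (p, s)) 2 ≤ M) :
    ∫ p, u τ p * ψ (p, τ) = ∫ p, u 0 p * ψ (p, 0) := by
  obtain ⟨χ, B, hB, hχ, hχc, hχ1, hχlim, hχB⟩ := exists_heis_cutoff n
  obtain ⟨N, hN⟩ := (isCompact_Icc (a := (0 : ℝ)) (b := τ)).exists_bound_of_continuousOn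
    (hu.continuousOn.mono fun s hs => hs.1)
  have hψs : ∀ s, ContDiff ℝ ∞ fun p => ψ (p, s) := fun s => by fun_prop
  set H : ℝ → Heis n → ℝ := fun s p => ‖ψ (p, s)‖ +
    2 * ∑ j, (‖heisX j (fun q => ψ (q, s)) p‖ + ‖heisY j (fun q => ψ (q, s)) p‖) with hH
  set MH : ℝ≥0∞ := M + 2 * ∑ _j : Fin n, (M + M) with hMH
  have hMHtop : MH ≠ ⊤ := by
    refine ENNReal.add_ne_top.2 ⟨hM, ENNReal.mul_ne_top (by norm_num) ?_⟩
    exact ENNReal.sum_ne_top.2 fun _ _ => ENNReal.add_ne_top.2 ⟨hM, hM⟩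
  have hHn : ∀ s ∈ Icc 0 τ, eLpNorm (H s) 2 ≤ MH := fun s hs => by
    have c0 : AEStronglyMeasurable (fun p => ‖ψ (p, s)‖) :=
      (hψs s).continuous.norm.aestronglyMeasurable
    have cX : ∀ j, AEStronglyMeasurable fun p => ‖heisX j (fun q => ψ (q, s)) p‖ := fun j =>
      (contDiff_heisX (hψs s) j).continuous.norm.aestronglyMeasurable
    have cY : ∀ j, AEStronglyMeasurable fun p => ‖heisY j (fun q => ψ (q, s)) p‖ := fun j =>
      (contDiff_heisY (hψs s) j).continuous.norm.aestronglyMeasurable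
    have cS : AEStronglyMeasurable fun p =>
        ∑ j, (‖heisX j (fun q => ψ (q, s)) p‖ + ‖heisY j (fun q => ψ (q, s)) p‖) :=
      Finset.aestronglyMeasurable_fun_sum _ fun j _ => (cX j).add (cY j)
    refine (eLpNorm_add_le c0 (cS.const_mul 2) (by norm_num)).trans (add_le_add ?_ ?_)
    · rw [eLpNorm_norm]; exact hM0 s hs
    · have h2 := eLpNorm_const_smul_le (c := (2 : ℝ)) (p := 2) (μ := volume) (f := fun p =>
        ∑ j, (‖heisX j (fun q => ψ (q, s)) p‖ + ‖heisY j (fun q => ψ (q, s)) p‖))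
      refine h2.trans ?_
      rw [Real.enorm_eq_ofReal zero_le_two, ENNReal.ofReal_ofNat]
      gcongr
      have h3 := eLpNorm_sum_le (p := 2) (μ := volume) (s := Finset.univ)
        (f := fun (j : Fin n) p =>
          ‖heisX j (fun q => ψ (q, s)) p‖ + ‖heisY j (fun q => ψ (q, s)) p‖)
        (fun j _ => (cX j).add (cY j)) (by norm_num)
      have h4 : (∑ j, fun p => ‖heisX j (fun q => ψ (q, s)) p‖ + ‖heisY j (fun q => ψ (q, s)) p‖) =
          fun p => ∑ j, (‖heisX j (fun q => ψ (q, s)) p‖ + ‖heisY j (fun q => ψ (q, s)) p‖) := by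
        ext p; exact Finset.sum_apply _ _ _
      rw [h4] at h3
      refine h3.trans (Finset.sum_le_sum fun j _ => ?_)
      refine (eLpNorm_add_le (cX j) (cY j) (by norm_num)).trans (add_le_add ?_ ?_)
      · rw [eLpNorm_norm]; exact hMX s hs j
      · rw [eLpNorm_norm]; exact hMY s hs j
  -- The commutator 𝓛(χψ) - χ𝓛ψ: each of its terms carries a derivative of the cutoff.
  set bracket : ℝ → ℝ → Heis n → ℂ := fun r s p =>
    subLaplacian (χ r) p * ψ (p, s) + 2 * ∑ j, (heisX j (χ r) p * heisX j (fun q => ψ (q, s)) p +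
      heisY j (χ r) p * heisY j (fun q => ψ (q, s)) p) with hbr
  have hbound : ∀ r, 0 ≤ r → r ≤ 1 → ∀ s p, ‖bracket r s p‖ ≤ r * B * ‖H s p‖ := by
    intro r h0 h1 s p
    obtain ⟨bX, bY, bL⟩ := hχB r h0 h1 p
    rw [Real.norm_of_nonneg (by positivity), hH, mul_add, mul_left_comm (r * B), Finset.mul_sum]
    refine (norm_add_le _ _).trans (add_le_add ?_ ?_)
    · rw [norm_mul]; gcongr
    · rw [norm_mul, show ‖(2 : ℂ)‖ = 2 by simp]
      gcongr
      refine (norm_sum_le _ _).trans (Finset.sum_le_sum fun j _ => ?_)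
      refine (norm_add_le _ _).trans ?_
      rw [norm_mul, norm_mul, mul_add]
      gcongr
      · exact bX j
      · exact bY j
  set F : ℝ → ℝ → ℂ := fun r s => ∫ p, u s p * (χ r p * ψ (p, s)) with hF
  have hderiv : ∀ r, 0 < r → r ≤ 1 → ∀ s ∈ Icc 0 τ,
      ∃ F', HasDerivWithinAt (F r) F' (Icc 0 τ) s ∧ ‖F'‖ ≤ r * (N * (B * MH.toReal)) := by
    intro r hr hr1 s hs
    have hcont : ContDiff ℝ ∞ fun q : Heis n × ℝ => χ r q.1 * ψ q :=
      ((hχ r).comp contDiff_fst).mul hψ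
    have hz : ∀ s, ∀ p ∉ tsupport (χ r), (fun q : Heis n × ℝ => χ r q.1 * ψ q) (p, s) = 0 :=
      fun s p hp => by simp [image_eq_zero_of_notMem_tsupport hp]
    have h1 := (hu.hasDerivWithinAt_pairing hcont (hχc r hr.ne') hz s hs.1).mono
      (t := Ici 0) (s := Icc 0 τ) fun x hx => hx.1
    refine ⟨_, h1, ?_⟩
    have hdiff : ∀ p, deriv (fun r' => χ r p * ψ (p, r')) s =
        χ r p * (-Complex.I * subLaplacian (fun q => ψ (q, s)) p) := fun p => by
      rw [deriv_const_mul_field']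
      exact congrArg (χ r p * ·) (hpde p s)
    have cb : Continuous fun p => bracket r s p := by
      have hX := fun j => (contDiff_heisX (hχ r) j).continuous
      have hY := fun j => (contDiff_heisY (hχ r) j).continuous
      have hX' := fun j => (contDiff_heisX (hψs s) j).continuous
      have hY' := fun j => (contDiff_heisY (hψs s) j).continuous
      have hL : Continuous (subLaplacian (χ r)) := continuous_finsetSum _ fun j _ =>
        (contDiff_heisX (contDiff_heisX (hχ r) j) j).continuous.add
        (contDiff_heisY (contDiff_heisY (hχ r) j) j).continuous
      have := (hψs s).continuous
      fun_prop
    have hbn : eLpNorm (bracket r s) 2 ≤ ENNReal.ofReal (r * B) * MH :=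
      (eLpNorm_le_mul_eLpNorm_of_ae_le_mul (Filter.Eventually.of_forall
        (hbound r hr.le hr1 s)) 2).trans (by gcongr; exact hHn s hs)
    have hbtop : ENNReal.ofReal (r * B) * MH ≠ ⊤ := ENNReal.mul_ne_top (by simp) hMHtop
    have hbm : MemLp (bracket r s) 2 :=
      ⟨cb.aestronglyMeasurable, lt_of_le_of_lt hbn hbtop.lt_top⟩
    have hcs : ∀ g : Heis n → ℂ, Continuous g → MemLp (fun p => χ r p * g p) 2 := fun g hg =>
      ((hχ r).continuous.mul hg).memLp_of_hasCompactSupport (hχc r hr.ne').mul_right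
    have hLc : Continuous fun p => subLaplacian (fun q => ψ (q, s)) p :=
      continuous_finsetSum _ fun j _ =>
        (contDiff_heisX (contDiff_heisX (hψs s) j) j).continuous.add
        (contDiff_heisY (contDiff_heisY (hψs s) j) j).continuous
    -- The terms with χ𝓛ψ cancel by the equation for ψ; only the commutator remains.
    have hval : Complex.I * (∫ p, u s p * subLaplacian (fun q => χ r q * ψ (q, s)) p) +
        ∫ p, u s p * deriv (fun r' => χ r p * ψ (p, r')) s =
        Complex.I * ∫ p, u s p * bracket r s p := by
      have e1 : ∀ p, u s p * subLaplacian (fun q => χ r q * ψ (q, s)) p =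
          u s p * (χ r p * subLaplacian (fun q => ψ (q, s)) p) + u s p * bracket r s p := fun p => by
        rw [subLaplacian_mul (hχ r) (hψs s)]; simp only [hbr]; ring
      have e2 : ∀ p, u s p * deriv (fun r' => χ r p * ψ (p, r')) s =
          -Complex.I * (u s p * (χ r p * subLaplacian (fun q => ψ (q, s)) p)) := fun p => by
        rw [hdiff]; ring
      simp_rw [e1, e2]
      rw [integral_add (integrable_mul_of_memLp _ (hcs _ hLc)) (integrable_mul_of_memLp _ hbm),
        integral_const_mul]
      ring
    rw [hval, norm_mul, Complex.norm_I, one_mul]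
    refine (norm_integral_mul_le _ hbm).trans ?_
    have h5 : (eLpNorm (bracket r s) 2).toReal ≤ r * B * MH.toReal := by
      refine (ENNReal.toReal_mono hbtop hbn).trans_eq ?_
      rw [ENNReal.toReal_mul, ENNReal.toReal_ofReal (by positivity)]
    calc _ ≤ N * (r * B * MH.toReal) :=
          mul_le_mul (hN s hs) h5 ENNReal.toReal_nonneg ((norm_nonneg _).trans (hN s hs))
      _ = _ := by ring
  have hmv : ∀ r, 0 < r → r ≤ 1 → ‖F r τ - F r 0‖ ≤ r * (N * (B * MH.toReal)) * (τ - 0) := by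
    intro r hr hr1
    choose! F' hF' hF'b using hderiv r hr hr1
    exact norm_image_sub_le_of_norm_deriv_le_segment' hF'
      (fun x hx => hF'b x ⟨hx.1, hx.2.le⟩) τ ⟨hτ, le_rfl⟩
  have hlim : ∀ s ∈ Icc 0 τ, Filter.Tendsto (fun r => F r s) (nhdsWithin 0 (Ioi 0))
      (nhds (∫ p, u s p * ψ (p, s))) := by
    intro s hs
    have hm : MemLp (fun p => ψ (p, s)) 2 :=
      ⟨(hψs s).continuous.aestronglyMeasurable, lt_of_le_of_lt (hM0 s hs) hM.lt_top⟩
    have hint := integrable_mul_of_memLp (u s) hm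
    refine tendsto_integral_filter_of_dominated_convergence (fun p => ‖u s p * ψ (p, s)‖)
      (Filter.Eventually.of_forall fun r => ?_) (Filter.Eventually.of_forall fun r =>
        Filter.Eventually.of_forall fun p => ?_) hint.norm
        (Filter.Eventually.of_forall fun p => ?_)
    · exact (Lp.aestronglyMeasurable _).mul
        ((hχ r).continuous.mul (hψs s).continuous).aestronglyMeasurable
    · rw [mul_left_comm, norm_mul]
      exact mul_le_of_le_one_left (norm_nonneg _) (hχ1 r p)
    · have := ((hχlim p).mono_left (nhdsWithin_le_nhds (s := Ioi 0))).mul_const (ψ (p, s))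
      simpa using this.const_mul (u s p)
  have hfin := ((hlim τ ⟨hτ, le_rfl⟩).sub (hlim 0 ⟨le_rfl, hτ⟩)).norm
  have hz : Filter.Tendsto (fun r : ℝ => r * (N * (B * MH.toReal)) * (τ - 0))
      (nhdsWithin 0 (Ioi 0)) (nhds 0) := by
    have : Continuous fun r : ℝ => r * (N * (B * MH.toReal)) * (τ - 0) := by fun_prop
    simpa using (this.tendsto 0).mono_left (nhdsWithin_le_nhds (s := Ioi 0))
  have hle := le_of_tendsto_of_tendsto hfin hz (by
    filter_upwards [Ioc_mem_nhdsGT (zero_lt_one (α := ℝ))] with r hr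
    exact hmv r hr.1 hr.2)
  exact sub_eq_zero.1 (norm_le_zero_iff.1 hle)

end Evolution

/-! ### The complex structure and the rotations it generates -/

section Symplectic

variable {n : ℕ}

/-- The standard complex structure `(x, y) ↦ (-y, x)` of `ℝ²ⁿ`. -/
noncomputable def planeJ (n : ℕ) : Plane n →ₗ[ℝ] Plane n where
  toFun z := WithLp.toLp 2 (Sum.elim (fun j => -z (Sum.inr j)) (fun j => z (Sum.inl j)))
  map_add' z w := by
    ext i
    rcases i with j | j <;> simp [add_comm]
  map_smul' c z := by
    ext i
    rcases i with j | j <;> simp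

@[simp] theorem planeJ_inl (z : Plane n) (j : Fin n) :
    planeJ n z (Sum.inl j) = -z (Sum.inr j) := rfl

@[simp] theorem planeJ_inr (z : Plane n) (j : Fin n) :
    planeJ n z (Sum.inr j) = z (Sum.inl j) := rfl

theorem inner_plane (z w : Plane n) :
    inner ℝ z w = ∑ j, (z (Sum.inl j) * w (Sum.inl j) + z (Sum.inr j) * w (Sum.inr j)) := by
  rw [PiLp.inner_apply, Fintype.sum_sum_type, ← Finset.sum_add_distrib]
  simp [mul_comm]

theorem inner_plane_single (z : Plane n) (i : Fin n ⊕ Fin n) :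
    inner ℝ z (EuclideanSpace.single i (1 : ℝ)) = z i := by
  simpa using EuclideanSpace.inner_single_right (𝕜 := ℝ) i (1 : ℝ) z

theorem norm_sq_plane (z : Plane n) :
    ‖z‖ ^ 2 = ∑ j, (z (Sum.inl j) ^ 2 + z (Sum.inr j) ^ 2) := by
  rw [← real_inner_self_eq_norm_sq, inner_plane]
  simp [sq]

/-- The rotation `cos θ + sin θ J` of `ℝ²ⁿ`. -/
noncomputable def planeRot (n : ℕ) (θ : ℝ) : Plane n →ₗᵢ[ℝ] Plane n where
  toLinearMap := Real.cos θ • LinearMap.id + Real.sin θ • planeJ n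
  norm_map' z := by
    rw [← sq_eq_sq₀ (norm_nonneg _) (norm_nonneg _), norm_sq_plane, norm_sq_plane]
    refine Finset.sum_congr rfl fun j _ => ?_
    simp
    linear_combination (z (Sum.inl j) ^ 2 + z (Sum.inr j) ^ 2) * Real.sin_sq_add_cos_sq θ

theorem planeRot_apply (θ : ℝ) (z : Plane n) :
    planeRot n θ z = Real.cos θ • z + Real.sin θ • planeJ n z := rfl

theorem planeJ_planeRot (θ : ℝ) (z : Plane n) :
    planeJ n (planeRot n θ z) = -(Real.sin θ • z) + Real.cos θ • planeJ n z := by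
  rw [planeRot_apply]
  ext i
  rcases i with j | j
  · simp
    ring
  · simp [add_comm]

end Symplectic

/-! ### The sub-Laplacian on exponentials of quadratic phases -/

section QuadraticPhase

variable {n : ℕ}

/-- The phase `iλt - μ|z|²/4 + κ⟨ζ, z⟩ + c`. -/
noncomputable def quadPhase (l m : ℝ) (κ c : ℂ) (ζ : Plane n) (p : Heis n) : ℂ :=
  Complex.I * l * (p.2 : ℂ) - m / 4 * ((‖p.1‖ ^ 2 : ℝ) : ℂ) + κ * ((inner ℝ ζ p.1 : ℝ) : ℂ) + c

theorem contDiff_quadPhase (l m : ℝ) (κ c : ℂ) (ζ : Plane n) :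
    ContDiff ℝ ∞ (quadPhase l m κ c ζ) := by
  have h : ∀ f : Heis n → ℝ, ContDiff ℝ ∞ f → ContDiff ℝ ∞ fun p => (f p : ℂ) := fun f hf =>
    Complex.ofRealCLM.contDiff.comp hf
  have h1 := h (fun p => p.2) contDiff_snd
  have h2 := h (fun p => ‖p.1‖ ^ 2) (contDiff_fst.norm_sq ℝ)
  have h3 := h (fun p => inner ℝ ζ p.1) (contDiff_const.inner ℝ contDiff_fst)
  unfold quadPhase
  fun_prop

theorem fderiv_quadPhase (l m : ℝ) (κ c : ℂ) (ζ : Plane n) (p : Heis n) (v : Plane n) (w : ℝ) :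
    fderiv ℝ (quadPhase l m κ c ζ) p (v, w) =
      Complex.I * l * w - m / 2 * ((inner ℝ p.1 v : ℝ) : ℂ) + κ * ((inner ℝ ζ v : ℝ) : ℂ) := by
  have h0 := ((contDiff_quadPhase l m κ c ζ).differentiable (by simp) p).hasFDerivAt
  have hline : HasDerivAt (fun h : ℝ => p + h • (v, w)) (v, w) 0 := by
    simpa using ((hasDerivAt_id (0 : ℝ)).smul_const (v, w)).const_add p
  have h1 : HasDerivAt (fun h : ℝ => quadPhase l m κ c ζ (p + h • (v, w)))
      (fderiv ℝ (quadPhase l m κ c ζ) p (v, w)) 0 := by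
    have h0' : HasFDerivAt (quadPhase l m κ c ζ) (fderiv ℝ (quadPhase l m κ c ζ) p)
      (p + (0 : ℝ) • (v, w)) := by simpa using h0
    exact h0'.comp_hasDerivAt 0 hline
  refine h1.unique ?_
  have e : (fun h : ℝ => quadPhase l m κ c ζ (p + h • (v, w))) = fun h : ℝ =>
      quadPhase l m κ c ζ p + (h : ℂ) * (Complex.I * l * w - m / 2 * ((inner ℝ p.1 v : ℝ) : ℂ) +
        κ * ((inner ℝ ζ v : ℝ) : ℂ)) - (h : ℂ) ^ 2 * (m / 4 * ((‖v‖ ^ 2 : ℝ) : ℂ)) := by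
    ext h
    simp only [quadPhase, Prod.fst_add, Prod.snd_add, Prod.smul_fst, Prod.smul_snd, smul_eq_mul]
    rw [norm_add_sq_real, inner_add_right, inner_smul_right, inner_smul_right, norm_smul, mul_pow,
      Real.norm_eq_abs, sq_abs]
    push_cast
    ring
  rw [e]
  have hid : HasDerivAt (fun h : ℝ => (h : ℂ)) 1 0 := Complex.ofRealCLM.hasDerivAt
  have := ((hid.mul_const (Complex.I * l * w - m / 2 * ((inner ℝ p.1 v : ℝ) : ℂ) +
        κ * ((inner ℝ ζ v : ℝ) : ℂ))).const_add (quadPhase l m κ c ζ p)).sub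
        ((hid.pow 2).mul_const (m / 4 * ((‖v‖ ^ 2 : ℝ) : ℂ)))
  refine (this.congr_deriv (by simp)).congr_of_eventuallyEq (Filter.Eventually.of_forall fun h => rfl)

/-- The logarithmic derivative of `exp (quadPhase ..)` along `X_j`. -/
noncomputable def quadPhaseX (l m : ℝ) (κ : ℂ) (ζ : Plane n) (j : Fin n) (z : Plane n) : ℂ :=
  Complex.I * l * (z (Sum.inr j) / 2) - m / 2 * z (Sum.inl j) + κ * ζ (Sum.inl j)

/-- The logarithmic derivative of `exp (quadPhase ..)` along `Y_j`. -/
noncomputable def quadPhaseY (l m : ℝ) (κ : ℂ) (ζ : Plane n) (j : Fin n) (z : Plane n) : ℂ :=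
  -(Complex.I * l * (z (Sum.inl j) / 2)) - m / 2 * z (Sum.inr j) + κ * ζ (Sum.inr j)

theorem heisX_cexp_quadPhase (l m : ℝ) (κ c : ℂ) (ζ : Plane n) (j : Fin n) :
    heisX j (fun p => Complex.exp (quadPhase l m κ c ζ p)) =
      fun p => Complex.exp (quadPhase l m κ c ζ p) * quadPhaseX l m κ ζ j p.1 := by
  ext p
  unfold heisX
  have h0 := ((contDiff_quadPhase l m κ c ζ).differentiable (by simp) p).hasFDerivAt
  rw [h0.cexp.fderiv, smul_apply, fderiv_quadPhase, smul_eq_mul]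
  simp [quadPhaseX, inner_plane_single]

theorem heisY_cexp_quadPhase (l m : ℝ) (κ c : ℂ) (ζ : Plane n) (j : Fin n) :
    heisY j (fun p => Complex.exp (quadPhase l m κ c ζ p)) =
      fun p => Complex.exp (quadPhase l m κ c ζ p) * quadPhaseY l m κ ζ j p.1 := by
  ext p
  unfold heisY
  have h0 := ((contDiff_quadPhase l m κ c ζ).differentiable (by simp) p).hasFDerivAt
  rw [h0.cexp.fderiv, smul_apply, fderiv_quadPhase, smul_eq_mul]
  simp [quadPhaseY, inner_plane_single]

/-- The coordinate functional `z ↦ z i` as a complex valued function on the Heisenberg group. -/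
noncomputable def heisCoord (n : ℕ) (i : Fin n ⊕ Fin n) : Heis n →L[ℝ] ℂ :=
  Complex.ofRealCLM.comp ((EuclideanSpace.proj i : Plane n →L[ℝ] ℝ).comp
    (ContinuousLinearMap.fst ℝ (Plane n) ℝ))

theorem quadPhaseX_eq (l m : ℝ) (κ : ℂ) (ζ : Plane n) (j : Fin n) (p : Heis n) :
    quadPhaseX l m κ ζ j p.1 = (Complex.I * l / 2) * heisCoord n (Sum.inr j) p +
      (-(m : ℂ) / 2) * heisCoord n (Sum.inl j) p + κ * ζ (Sum.inl j) := by
  simp [quadPhaseX, heisCoord]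
  ring

theorem quadPhaseY_eq (l m : ℝ) (κ : ℂ) (ζ : Plane n) (j : Fin n) (p : Heis n) :
    quadPhaseY l m κ ζ j p.1 = (-(Complex.I * l) / 2) * heisCoord n (Sum.inl j) p +
      (-(m : ℂ) / 2) * heisCoord n (Sum.inr j) p + κ * ζ (Sum.inr j) := by
  simp [quadPhaseY, heisCoord]
  ring

theorem contDiff_quadPhaseX (l m : ℝ) (κ : ℂ) (ζ : Plane n) (j : Fin n) :
    ContDiff ℝ ∞ fun p : Heis n => quadPhaseX l m κ ζ j p.1 := by
  simp_rw [quadPhaseX_eq]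
  fun_prop

theorem contDiff_quadPhaseY (l m : ℝ) (κ : ℂ) (ζ : Plane n) (j : Fin n) :
    ContDiff ℝ ∞ fun p : Heis n => quadPhaseY l m κ ζ j p.1 := by
  simp_rw [quadPhaseY_eq]
  fun_prop

theorem heisX_quadPhaseX (l m : ℝ) (κ : ℂ) (ζ : Plane n) (j : Fin n) (p : Heis n) :
    heisX j (fun p : Heis n => quadPhaseX l m κ ζ j p.1) p = -m / 2 := by
  simp_rw [quadPhaseX_eq]
  unfold heisX
  have h := ((((heisCoord n (Sum.inr j)).hasFDerivAt (x := p)).const_mul (Complex.I * l / 2)).add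
    (((heisCoord n (Sum.inl j)).hasFDerivAt (x := p)).const_mul (-(m : ℂ) / 2))).add_const
      (κ * ζ (Sum.inl j))
  have h' := h.fderiv
  refine (congrArg (fun T => T (EuclideanSpace.single (Sum.inl j) (1 : ℝ), p.1 (Sum.inr j) / 2)) h').trans ?_
  simp [heisCoord]

theorem heisY_quadPhaseY (l m : ℝ) (κ : ℂ) (ζ : Plane n) (j : Fin n) (p : Heis n) :
    heisY j (fun p : Heis n => quadPhaseY l m κ ζ j p.1) p = -m / 2 := by
  simp_rw [quadPhaseY_eq]
  unfold heisY
  have h := ((((heisCoord n (Sum.inl j)).hasFDerivAt (x := p)).const_mul (-(Complex.I * l) / 2)).add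
    (((heisCoord n (Sum.inr j)).hasFDerivAt (x := p)).const_mul (-(m : ℂ) / 2))).add_const
      (κ * ζ (Sum.inr j))
  have h' := h.fderiv
  refine (congrArg (fun T => T (EuclideanSpace.single (Sum.inr j) (1 : ℝ), -(p.1 (Sum.inl j) / 2))) h').trans ?_
  simp [heisCoord]

/-- The quadratic term in z of the logarithmic expression is (m² - l²)|z|²/4. At the critical width
m² = l² it disappears, leaving an affine function of z, so the family of such exponentials is
preserved by the flow. -/
theorem subLaplacian_cexp_quadPhase {l m : ℝ} (hlm : m ^ 2 = l ^ 2) (κ c : ℂ) (ζ : Plane n)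
    (p : Heis n) :
    subLaplacian (fun p => Complex.exp (quadPhase l m κ c ζ p)) p =
      Complex.exp (quadPhase l m κ c ζ p) * (κ ^ 2 * ((‖ζ‖ ^ 2 : ℝ) : ℂ) -
        κ * m * ((inner ℝ ζ p.1 : ℝ) : ℂ) +
        Complex.I * κ * l * ((inner ℝ (planeJ n ζ) p.1 : ℝ) : ℂ) - n * m) := by
  have hlm' : (m : ℂ) ^ 2 = (l : ℂ) ^ 2 := by exact_mod_cast hlm
  have hE : ContDiff ℝ ∞ fun p => Complex.exp (quadPhase l m κ c ζ p) :=
    (contDiff_quadPhase l m κ c ζ).cexp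
  unfold subLaplacian
  have hterm : ∀ j : Fin n,
      heisX j (heisX j fun p => Complex.exp (quadPhase l m κ c ζ p)) p +
        heisY j (heisY j fun p => Complex.exp (quadPhase l m κ c ζ p)) p =
      Complex.exp (quadPhase l m κ c ζ p) *
        (κ ^ 2 * ((ζ (Sum.inl j) ^ 2 + ζ (Sum.inr j) ^ 2 : ℝ) : ℂ) -
          κ * m * ((ζ (Sum.inl j) * p.1 (Sum.inl j) + ζ (Sum.inr j) * p.1 (Sum.inr j) : ℝ) : ℂ) +
          Complex.I * κ * l * ((planeJ n ζ (Sum.inl j) * p.1 (Sum.inl j) +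
            planeJ n ζ (Sum.inr j) * p.1 (Sum.inr j) : ℝ) : ℂ) - m) := fun j => by
    rw [heisX_cexp_quadPhase, heisY_cexp_quadPhase, heisX_mul hE (contDiff_quadPhaseX l m κ ζ j),
      heisY_mul hE (contDiff_quadPhaseY l m κ ζ j), heisX_cexp_quadPhase, heisY_cexp_quadPhase]
    simp only [heisX_quadPhaseX, heisY_quadPhaseY]
    simp only [quadPhaseX, quadPhaseY, planeJ_inl, planeJ_inr]
    push_cast
    linear_combination (Complex.exp (quadPhase l m κ c ζ p) *
      ((p.1 (Sum.inl j) : ℂ) ^ 2 + (p.1 (Sum.inr j) : ℂ) ^ 2) / 4) * hlm' +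
      (Complex.exp (quadPhase l m κ c ζ p) * (l : ℂ) ^ 2 *
      ((p.1 (Sum.inl j) : ℂ) ^ 2 + (p.1 (Sum.inr j) : ℂ) ^ 2) / 4) * Complex.I_sq
  rw [Finset.sum_congr rfl fun j _ => hterm j, ← Finset.mul_sum, norm_sq_plane, inner_plane,
    inner_plane]
  congr 1
  push_cast
  rw [Finset.sum_sub_distrib, Finset.sum_add_distrib, Finset.sum_sub_distrib, ← Finset.mul_sum,
    ← Finset.mul_sum, ← Finset.mul_sum]
  simp

end QuadraticPhase

/-! ### Coherent states as explicit solutions -/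

section WavePacket

variable {n : ℕ}

theorem subLaplacian_const_mul {φ : Heis n → ℂ} (hφ : ContDiff ℝ ∞ φ) (c : ℂ) (p : Heis n) :
    subLaplacian (fun p => c * φ p) p = c * subLaplacian φ p := by
  unfold subLaplacian
  rw [Finset.mul_sum]
  refine Finset.sum_congr rfl fun j _ => ?_
  rw [heisX_const_mul hφ, heisY_const_mul hφ, heisX_const_mul (contDiff_heisX hφ j),
    heisY_const_mul (contDiff_heisY hφ j)]
  ring

/-- The phase at time `σ` of the coherent state with `t`-frequency `ν` that is
`exp (-π|ν||z|²/2 + i⟨η, z⟩)` at time zero. -/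
noncomputable def coherentPhase (η : Plane n) (ν σ : ℝ) (p : Heis n) : ℂ :=
  quadPhase (-2 * Real.pi * ν) (2 * Real.pi * |ν|)
    (Complex.I * Complex.exp (Complex.I * (2 * Real.pi * |ν| : ℝ) * σ))
    (Complex.I * n * (2 * Real.pi * |ν| : ℝ) * σ + ((‖η‖ ^ 2 : ℝ) : ℂ) *
      (Complex.exp (2 * (Complex.I * (2 * Real.pi * |ν| : ℝ) * σ)) - 1) /
        (2 * (2 * Real.pi * |ν| : ℝ)))
    (planeRot n (-2 * Real.pi * ν * σ) η) p

theorem inner_planeRot (θ : ℝ) (η z : Plane n) : inner ℝ (planeRot n θ η) z =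
    Real.cos θ * inner ℝ η z + Real.sin θ * inner ℝ (planeJ n η) z := by
  rw [planeRot_apply, inner_add_left, inner_smul_left, inner_smul_left]
  rfl

theorem inner_planeJ_planeRot (θ : ℝ) (η z : Plane n) :
    inner ℝ (planeJ n (planeRot n θ η)) z =
      -(Real.sin θ * inner ℝ η z) + Real.cos θ * inner ℝ (planeJ n η) z := by
  rw [planeJ_planeRot, inner_add_left, inner_neg_left, inner_smul_left, inner_smul_left]
  rfl

/-- With l = -2πν and m = 2π|ν|, comparing coefficients in `subLaplacian_cexp_quadPhase` reduces the
equation to κ' = imκ, ζ' = lJζ and c' = inm - iκ²|ζ|². From κ = i, ζ = η, c = 0 these integrate to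
the parameters of `coherentPhase`; integrating κ² divides by 2m, hence ν ≠ 0. -/
theorem hasDerivAt_cexp_coherentPhase (η : Plane n) {ν : ℝ} (hν : ν ≠ 0) (σ : ℝ) (p : Heis n) :
    HasDerivAt (fun σ => Complex.exp (coherentPhase η ν σ p))
      (-Complex.I * subLaplacian (fun q => Complex.exp (coherentPhase η ν σ q)) p) σ := by
  have hlm : (2 * Real.pi * |ν|) ^ 2 = (-2 * Real.pi * ν) ^ 2 := by
    rw [mul_pow, sq_abs]; ring
  have hm : ((2 * Real.pi * |ν| : ℝ) : ℂ) ≠ 0 := by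
    have : 2 * Real.pi * |ν| ≠ 0 := by positivity
    exact_mod_cast this
  have hL := subLaplacian_cexp_quadPhase hlm
    (Complex.I * Complex.exp (Complex.I * (2 * Real.pi * |ν| : ℝ) * σ))
    (Complex.I * n * (2 * Real.pi * |ν| : ℝ) * σ + ((‖η‖ ^ 2 : ℝ) : ℂ) *
      (Complex.exp (2 * (Complex.I * (2 * Real.pi * |ν| : ℝ) * σ)) - 1) /
        (2 * (2 * Real.pi * |ν| : ℝ)))
    (planeRot n (-2 * Real.pi * ν * σ) η) p
  rw [LinearIsometry.norm_map] at hL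
  have hQ : HasDerivAt (fun σ => coherentPhase η ν σ p)
      (Complex.I * (2 * Real.pi * |ν| : ℝ) * (Complex.I *
        Complex.exp (Complex.I * (2 * Real.pi * |ν| : ℝ) * σ)) *
        ((inner ℝ (planeRot n (-2 * Real.pi * ν * σ) η) p.1 : ℝ) : ℂ) +
      (Complex.I * Complex.exp (Complex.I * (2 * Real.pi * |ν| : ℝ) * σ)) *
        ((-2 * Real.pi * ν : ℝ) *
          ((inner ℝ (planeJ n (planeRot n (-2 * Real.pi * ν * σ) η)) p.1 : ℝ) : ℂ)) +
      (Complex.I * n * (2 * Real.pi * |ν| : ℝ) + Complex.I * ((‖η‖ ^ 2 : ℝ) : ℂ) *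
        Complex.exp (2 * (Complex.I * (2 * Real.pi * |ν| : ℝ) * σ)))) σ := by
    set m : ℝ := 2 * Real.pi * |ν| with hmdef
    set l : ℝ := -2 * Real.pi * ν with hldef
    have hσ : HasDerivAt (fun σ : ℝ => (σ : ℂ)) 1 σ := Complex.ofRealCLM.hasDerivAt
    have h1 : HasDerivAt (fun σ : ℝ => Complex.I * (m : ℂ) * (σ : ℂ)) (Complex.I * m) σ := by
      simpa using hσ.const_mul (Complex.I * (m : ℂ))
    have h2 := h1.cexp.const_mul Complex.I
    have h3 := (h1.const_mul 2).cexp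
    have hl : HasDerivAt (fun σ : ℝ => l * σ) l σ := by
      simpa using (hasDerivAt_id σ).const_mul l
    have h4 : HasDerivAt (fun σ : ℝ => inner ℝ (planeRot n (l * σ) η) p.1)
        (l * inner ℝ (planeJ n (planeRot n (l * σ) η)) p.1) σ := by
      simp_rw [inner_planeRot, inner_planeJ_planeRot]
      refine ((hl.cos.mul_const _).add (hl.sin.mul_const _)).congr_deriv ?_
      ring
    have h5 := h4.ofReal_comp
    have h6 := (h2.mul h5).add (((hσ.const_mul (Complex.I * n * m))).add
      (((h3.sub_const 1).const_mul ((‖η‖ ^ 2 : ℝ) : ℂ)).div_const (2 * (m : ℂ))))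
    have h7 := h6.const_add (Complex.I * l * (p.2 : ℂ) - m / 4 * ((‖p.1‖ ^ 2 : ℝ) : ℂ))
    refine (h7.congr_deriv ?_).congr_of_eventuallyEq (Filter.Eventually.of_forall fun x => ?_)
    · push_cast
      field_simp
    · simp only [coherentPhase, quadPhase, Pi.add_apply, Pi.mul_apply]
      ring
  refine hQ.cexp.congr_deriv ?_
  have hL' : subLaplacian (fun q => Complex.exp (coherentPhase η ν σ q)) p = _ := hL
  rw [hL']
  have e2 : Complex.exp (2 * (Complex.I * (2 * Real.pi * |ν| : ℝ) * σ)) =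
      Complex.exp (Complex.I * (2 * Real.pi * |ν| : ℝ) * σ) ^ 2 := by
    rw [← Complex.exp_nat_mul]; norm_num
  rw [e2, show Complex.exp (coherentPhase η ν σ p) = Complex.exp (quadPhase _ _ _ _ _ p) from rfl, e2]
  set E := Complex.exp (Complex.I * (2 * Real.pi * |ν| : ℝ) * σ)
  generalize Complex.exp (quadPhase _ _ _ _ _ p) = W
  push_cast
  ring_nf
  simp only [Complex.I_sq, show Complex.I ^ 3 = -Complex.I by rw [pow_succ, Complex.I_sq]; ring]
  ring

theorem contDiffAt_coherentPhase (η : Plane n) (τ : ℝ) {q : (Heis n × ℝ) × ℝ} (hq : q.2 ≠ 0) :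
    ContDiffAt ℝ ∞ (fun q : (Heis n × ℝ) × ℝ => coherentPhase η q.2 (q.1.2 - τ) q.1.1) q := by
  have hof : ∀ f : (Heis n × ℝ) × ℝ → ℝ, ContDiffAt ℝ ∞ f q →
      ContDiffAt ℝ ∞ (fun q => (f q : ℂ)) q := fun f hf =>
    Complex.ofRealCLM.contDiff.contDiffAt.comp q hf
  have hσ : ContDiffAt ℝ ∞ (fun q : (Heis n × ℝ) × ℝ => q.1.2 - τ) q := by fun_prop
  have hν : ContDiffAt ℝ ∞ (fun q : (Heis n × ℝ) × ℝ => q.2) q := by fun_prop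
  have hz : ContDiffAt ℝ ∞ (fun q : (Heis n × ℝ) × ℝ => q.1.1.1) q := by fun_prop
  have ht : ContDiffAt ℝ ∞ (fun q : (Heis n × ℝ) × ℝ => q.1.1.2) q := by fun_prop
  have hm : ContDiffAt ℝ ∞ (fun q : (Heis n × ℝ) × ℝ => 2 * Real.pi * |q.2|) q :=
    contDiffAt_const.mul (hν.abs hq)
  have hl : ContDiffAt ℝ ∞ (fun q : (Heis n × ℝ) × ℝ => -2 * Real.pi * q.2) q :=
    contDiffAt_const.mul hν
  have hσ' := hof _ hσ
  have hm' := hof _ hm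
  have hl' := hof _ hl
  have ht' := hof _ ht
  have hn' := hof _ (hz.norm_sq ℝ)
  have hin : ContDiffAt ℝ ∞ (fun q : (Heis n × ℝ) × ℝ =>
      inner ℝ (planeRot n (-2 * Real.pi * q.2 * (q.1.2 - τ)) η) q.1.1.1) q := by
    simp_rw [inner_planeRot]
    exact ((hl.mul hσ).cos.mul (contDiffAt_const.inner ℝ hz)).add
      ((hl.mul hσ).sin.mul (contDiffAt_const.inner ℝ hz))
  have hin' := hof _ hin
  have hIm := (contDiffAt_const (c := Complex.I)).mul hm' |>.mul hσ'
  have hm0 : (2 * ((2 * Real.pi * |q.2| : ℝ) : ℂ)) ≠ 0 := by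
    have : 2 * Real.pi * |q.2| ≠ 0 := by positivity
    exact mul_ne_zero two_ne_zero (by exact_mod_cast this)
  unfold coherentPhase quadPhase
  refine ContDiffAt.add (ContDiffAt.add (ContDiffAt.sub ?_ ?_) ?_) (ContDiffAt.add ?_ ?_)
  · exact (contDiffAt_const.mul hl').mul ht'
  · exact (hm'.div_const 4).mul hn'
  · exact (contDiffAt_const.mul hIm.cexp).mul hin'
  · exact (contDiffAt_const.mul hm').mul hσ'
  · simp_rw [div_eq_mul_inv]
    exact (contDiffAt_const.mul ((contDiffAt_const.mul hIm).cexp.sub contDiffAt_const)).mul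
      ((contDiffAt_const.mul hm').inv hm0)

/-- The phase involves |ν| and 1/|ν|, so it is smooth only off ν = 0; the amplitude g removes a
neighbourhood of that frequency. -/
theorem contDiff_mul_cexp_coherentPhase {g : ℝ → ℝ} (hg : ContDiff ℝ ∞ g)
    (hg0 : tsupport g ⊆ {0}ᶜ) (η : Plane n) (τ : ℝ) :
    ContDiff ℝ ∞ fun q : (Heis n × ℝ) × ℝ =>
      (g q.2 : ℂ) * Complex.exp (coherentPhase η q.2 (q.1.2 - τ) q.1.1) := by
  rw [contDiff_iff_contDiffAt]
  intro q
  by_cases hq : q.2 ∈ tsupport g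
  · have hg' : ContDiff ℝ ∞ fun q : (Heis n × ℝ) × ℝ => (g q.2 : ℂ) :=
      Complex.ofRealCLM.contDiff.comp (hg.comp contDiff_snd)
    exact hg'.contDiffAt.mul (contDiffAt_coherentPhase η τ (hg0 hq)).cexp
  · refine (contDiffAt_const (c := (0 : ℂ))).congr_of_eventuallyEq ?_
    have : Prod.snd ⁻¹' (tsupport g)ᶜ ∈ nhds q :=
      ((isClosed_tsupport g).isOpen_compl.preimage continuous_snd).mem_nhds hq
    filter_upwards [this] with q' hq'
    rw [image_eq_zero_of_notMem_tsupport hq']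
    simp

end WavePacket

/-! ### Gaussian envelopes -/

section GaussianDomination

variable {n : ℕ}

theorem integrable_gaussian_plane {b : ℝ} (hb : 0 < b) :
    Integrable fun z : Plane n => Real.exp (-b * ‖z‖ ^ 2) := by
  have h := (GaussianFourier.integrable_cexp_neg_mul_sq_norm_add (V := Plane n) (b := (b : ℂ))
    (by simpa using hb) 0 0).norm
  refine h.congr (Filter.Eventually.of_forall fun z => ?_)
  simp only [zero_mul, add_zero, Complex.norm_exp]
  congr 1
  rw [← Complex.ofReal_neg, ← Complex.ofReal_pow, ← Complex.ofReal_mul, Complex.ofReal_re]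

theorem memLp_gaussian_plane {b : ℝ} (hb : 0 < b) :
    MemLp (fun z : Plane n => Real.exp (-b * ‖z‖ ^ 2)) 2 := by
  rw [memLp_two_iff_integrable_sq (by fun_prop)]
  refine (integrable_gaussian_plane (b := 2 * b) (by positivity)).congr
    (Filter.Eventually.of_forall fun z => ?_)
  simp only []
  rw [← Real.exp_nat_mul]
  congr 1
  push_cast
  ring

theorem MeasureTheory.MemLp.mul_prod_two {X Y : Type*} [MeasureSpace X] [MeasureSpace Y]
    [SFinite (volume : Measure X)] [SFinite (volume : Measure Y)] {f : X → ℝ} {g : Y → ℝ}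
    (hf : MemLp f 2) (hg : MemLp g 2) : MemLp (fun p : X × Y => f p.1 * g p.2) 2 := by
  have h1 : AEStronglyMeasurable fun p : X × Y => f p.1 * g p.2 :=
    (hf.1.comp_quasiMeasurePreserving Measure.quasiMeasurePreserving_fst).mul
      (hg.1.comp_quasiMeasurePreserving Measure.quasiMeasurePreserving_snd)
  rw [memLp_two_iff_integrable_sq h1]
  have h2 := (memLp_two_iff_integrable_sq hf.1).1 hf
  have h3 := (memLp_two_iff_integrable_sq hg.1).1 hg
  refine (h2.mul_prod h3).congr (Filter.Eventually.of_forall fun p => ?_)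
  simp only [mul_pow]

/-- The bound M is chosen before Ψ, which is what yields L² estimates uniform in time. -/
theorem exists_bound_of_gaussian_domination (n : ℕ) {K : Set ℝ} (hK : IsCompact K) {b : ℝ}
    (hb : 0 < b) (C : ℝ) :
    ∃ M : ℝ≥0∞, M ≠ ⊤ ∧ ∀ Ψ : Plane n × ℝ → ℂ, Continuous Ψ →
      (∀ z ν, ‖Ψ (z, ν)‖ ≤ K.indicator (fun _ => C * Real.exp (-b * ‖z‖ ^ 2)) ν) →
      MemLp Ψ 2 ∧ (∀ z, Integrable fun ν => Ψ (z, ν)) ∧ eLpNorm Ψ 2 ≤ M := by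
  have henv : MemLp (fun p : Plane n × ℝ =>
      Real.exp (-b * ‖p.1‖ ^ 2) * K.indicator (fun _ => C) p.2) 2 :=
    (memLp_gaussian_plane (n := n) hb).mul_prod_two
      (memLp_indicator_const 2 hK.measurableSet C (Or.inr hK.measure_lt_top.ne))
  refine ⟨_, henv.2.ne, fun Ψ hΨ hle' => ?_⟩
  have hle : ∀ p, ‖Ψ p‖ ≤ Real.exp (-b * ‖p.1‖ ^ 2) * K.indicator (fun _ => C) p.2 := fun p =>
    (hle' p.1 p.2).trans_eq (by
      by_cases hp : p.2 ∈ K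
      · rw [indicator_of_mem hp, indicator_of_mem hp, mul_comm]
      · rw [indicator_of_notMem hp, indicator_of_notMem hp, mul_zero])
  refine ⟨henv.mono hΨ.aestronglyMeasurable (Filter.Eventually.of_forall fun p =>
    (hle p).trans (Real.le_norm_self _)), fun z => ?_, eLpNorm_mono_real hle⟩
  refine integrable_slice_of_compact hΨ hK (fun z ν hν => ?_) z
  have := hle' z ν
  rw [indicator_of_notMem hν] at this
  exact norm_le_zero_iff.1 this

end GaussianDomination

/-! ### Wave packets and their uniform bounds -/

section WavePacketEvolution

variable {n : ℕ}

/-- The superposition, with amplitude `g`, of the coherent states with parameter `η`: here `σ` is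
the time and the second argument is the frequency in `t`. -/
noncomputable def wavePacket (g : ℝ → ℝ) (η : Plane n) (σ : ℝ) (q : Plane n × ℝ) : ℂ :=
  (g q.2 : ℂ) * Complex.exp (coherentPhase η q.2 σ (q.1, 0))

theorem coherentPhase_eq (η : Plane n) (ν σ : ℝ) (p : Heis n) :
    coherentPhase η ν σ p = Complex.I * (-2 * Real.pi * ν : ℝ) * (p.2 : ℂ) +
      coherentPhase η ν σ (p.1, 0) := by
  simp [coherentPhase, quadPhase]
  ring

theorem fourierChar_smul_eq (ν t : ℝ) (w : ℂ) : Real.fourierChar (-(ν * t)) • w =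
    Complex.exp (Complex.I * (-2 * Real.pi * ν : ℝ) * (t : ℂ)) * w := by
  rw [Circle.smul_def, Real.fourierChar_apply, smul_eq_mul]
  congr 2
  push_cast
  ring

theorem partialFourier_wavePacket (g : ℝ → ℝ) (η : Plane n) (σ : ℝ) (p : Heis n) :
    partialFourier (wavePacket g η σ) p =
      ∫ ν, (g ν : ℂ) * Complex.exp (coherentPhase η ν σ p) := by
  unfold partialFourier
  rw [Real.fourier_real_eq]
  refine integral_congr_ae (Filter.Eventually.of_forall fun ν => ?_)
  simp only [wavePacket]
  rw [fourierChar_smul_eq, coherentPhase_eq η ν σ p, Complex.exp_add]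
  ring

theorem partialFourier_heisX_wavePacket (g : ℝ → ℝ) (η : Plane n) (σ : ℝ) (j : Fin n)
    (p : Heis n) :
    partialFourier (fun q => heisX j (fun p => (g q.2 : ℂ) *
      Complex.exp (coherentPhase η q.2 σ p)) (q.1, 0)) p =
      ∫ ν, heisX j (fun p => (g ν : ℂ) * Complex.exp (coherentPhase η ν σ p)) p := by
  unfold partialFourier
  rw [Real.fourier_real_eq]
  refine integral_congr_ae (Filter.Eventually.of_forall fun ν => ?_)
  simp only [coherentPhase]
  rw [fourierChar_smul_eq, heisX_const_mul (contDiff_quadPhase _ _ _ _ _).cexp,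
    heisX_cexp_quadPhase]
  simp only []
  have := coherentPhase_eq η ν σ p
  unfold coherentPhase at this
  rw [this, Complex.exp_add]
  ring

theorem partialFourier_heisY_wavePacket (g : ℝ → ℝ) (η : Plane n) (σ : ℝ) (j : Fin n)
    (p : Heis n) :
    partialFourier (fun q => heisY j (fun p => (g q.2 : ℂ) *
      Complex.exp (coherentPhase η q.2 σ p)) (q.1, 0)) p =
      ∫ ν, heisY j (fun p => (g ν : ℂ) * Complex.exp (coherentPhase η ν σ p)) p := by
  unfold partialFourier
  rw [Real.fourier_real_eq]
  refine integral_congr_ae (Filter.Eventually.of_forall fun ν => ?_)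
  simp only [coherentPhase]
  rw [fourierChar_smul_eq, heisY_const_mul (contDiff_quadPhase _ _ _ _ _).cexp,
    heisY_cexp_quadPhase]
  simp only []
  have := coherentPhase_eq η ν σ p
  unfold coherentPhase at this
  rw [this, Complex.exp_add]
  ring

/-- Time enters the real part of the phase only through -sin(mσ)⟨Rη, z⟩, with R a rotation, and a
multiple of cos(2mσ) - 1 that is nonpositive. Both are controlled without reference to σ. -/
theorem norm_cexp_coherentPhase_le (η : Plane n) {ν : ℝ} (hν : ν ≠ 0) (σ : ℝ) (z : Plane n) :
    ‖Complex.exp (coherentPhase η ν σ (z, 0))‖ ≤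
      Real.exp (-(Real.pi / 2 * |ν|) * ‖z‖ ^ 2 + ‖η‖ * ‖z‖) := by
  rw [Complex.norm_exp]
  refine Real.exp_le_exp.2 ?_
  unfold coherentPhase quadPhase
  set m : ℝ := 2 * Real.pi * |ν| with hm
  have hmpos : 0 < m := by positivity
  set ip : ℝ := inner ℝ (planeRot n (-2 * Real.pi * ν * σ) η) z with hip
  have hip' : |ip| ≤ ‖η‖ * ‖z‖ := by
    refine (abs_real_inner_le_norm _ _).trans_eq ?_
    rw [LinearIsometry.norm_map]
  have e1 : ∀ x : ℝ, Complex.exp (Complex.I * (x : ℂ)) = Real.cos x + Real.sin x * Complex.I :=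
    fun x => by rw [mul_comm, Complex.exp_mul_I]; simp
  have e2 : Complex.I * (m : ℂ) * (σ : ℂ) = Complex.I * ((m * σ : ℝ) : ℂ) := by push_cast; ring
  have e3 : 2 * (Complex.I * (m : ℂ) * (σ : ℂ)) = Complex.I * ((2 * (m * σ) : ℝ) : ℂ) := by
    push_cast; ring
  have e4 : ((‖η‖ ^ 2 : ℝ) : ℂ) * (Complex.exp (2 * (Complex.I * (m : ℂ) * (σ : ℂ))) - 1) /
      (2 * (m : ℂ)) = ((‖η‖ ^ 2 / (2 * m) : ℝ) : ℂ) *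
        (Complex.exp (2 * (Complex.I * (m : ℂ) * (σ : ℂ))) - 1) := by
    push_cast; ring
  have e5 : (m : ℂ) / 4 * ((‖z‖ ^ 2 : ℝ) : ℂ) = ((m / 4 * ‖z‖ ^ 2 : ℝ) : ℂ) := by push_cast; ring
  have e6 : Complex.I * (n : ℂ) * (m : ℂ) * (σ : ℂ) = Complex.I * ((n * m * σ : ℝ) : ℂ) := by
    push_cast; ring
  simp only [Complex.ofReal_zero, mul_zero, zero_sub]
  rw [e4, e3, e2, e1, e1, e5, e6]
  have hre : (-((m / 4 * ‖z‖ ^ 2 : ℝ) : ℂ) + Complex.I *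
      (Real.cos (m * σ) + Real.sin (m * σ) * Complex.I) * (ip : ℂ) +
      (Complex.I * ((n * m * σ : ℝ) : ℂ) + ((‖η‖ ^ 2 / (2 * m) : ℝ) : ℂ) *
        (Real.cos (2 * (m * σ)) + Real.sin (2 * (m * σ)) * Complex.I - 1))).re =
      -(m / 4 * ‖z‖ ^ 2) - Real.sin (m * σ) * ip +
        ‖η‖ ^ 2 / (2 * m) * (Real.cos (2 * (m * σ)) - 1) := by
    simp only [Complex.add_re, Complex.neg_re, Complex.mul_re, Complex.ofReal_re, Complex.ofReal_im,
      Complex.I_re, Complex.I_im, Complex.add_im, Complex.mul_im, Complex.sub_re, Complex.sub_im,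
      Complex.one_re, Complex.one_im]
    ring
  rw [hre]
  have h1 : -(Real.sin (m * σ) * ip) ≤ ‖η‖ * ‖z‖ := by
    refine (neg_le_abs _).trans ?_
    rw [abs_mul]
    calc _ ≤ 1 * |ip| := by gcongr; exact Real.abs_sin_le_one _
      _ ≤ _ := by rw [one_mul]; exact hip'
  have h2 : ‖η‖ ^ 2 / (2 * m) * (Real.cos (2 * (m * σ)) - 1) ≤ 0 :=
    mul_nonpos_of_nonneg_of_nonpos (by positivity) (by linarith [Real.cos_le_one (2 * (m * σ))])
  have h3 : m / 4 = Real.pi / 2 * |ν| := by rw [hm]; ring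
  rw [← h3]
  linarith

theorem abs_coord_le_norm (z : Plane n) (i : Fin n ⊕ Fin n) : |z i| ≤ ‖z‖ := by
  simpa using PiLp.norm_apply_le z i

theorem norm_quadPhaseX_le (l m : ℝ) {κ : ℂ} (hκ : ‖κ‖ = 1) (ζ : Plane n) (j : Fin n)
    (z : Plane n) : ‖quadPhaseX l m κ ζ j z‖ ≤ (|l| + |m|) * ‖z‖ + ‖ζ‖ := by
  unfold quadPhaseX
  refine (norm_add_le _ _).trans (add_le_add ((norm_sub_le _ _).trans ?_) ?_)
  · have h1 := abs_coord_le_norm z (Sum.inr j)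
    have h2 := abs_coord_le_norm z (Sum.inl j)
    simp only [norm_mul, norm_div, Complex.norm_I, Complex.norm_real, Real.norm_eq_abs, one_mul,
      Complex.norm_ofNat]
    nlinarith [abs_nonneg l, abs_nonneg m, abs_nonneg (z (Sum.inr j)), abs_nonneg (z (Sum.inl j)),
      mul_le_mul_of_nonneg_left h1 (abs_nonneg l), mul_le_mul_of_nonneg_left h2 (abs_nonneg m),
      mul_nonneg (abs_nonneg l) (norm_nonneg z), mul_nonneg (abs_nonneg m) (norm_nonneg z)]
  · rw [norm_mul, hκ, one_mul, Complex.norm_real]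
    exact abs_coord_le_norm ζ _

theorem norm_quadPhaseY_le (l m : ℝ) {κ : ℂ} (hκ : ‖κ‖ = 1) (ζ : Plane n) (j : Fin n)
    (z : Plane n) : ‖quadPhaseY l m κ ζ j z‖ ≤ (|l| + |m|) * ‖z‖ + ‖ζ‖ := by
  unfold quadPhaseY
  refine (norm_add_le _ _).trans (add_le_add ((norm_sub_le _ _).trans ?_) ?_)
  · have h1 := abs_coord_le_norm z (Sum.inl j)
    have h2 := abs_coord_le_norm z (Sum.inr j)
    simp only [norm_mul, norm_div, norm_neg, Complex.norm_I, Complex.norm_real, Real.norm_eq_abs,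
      one_mul, Complex.norm_ofNat]
    nlinarith [abs_nonneg l, abs_nonneg m, abs_nonneg (z (Sum.inr j)), abs_nonneg (z (Sum.inl j)),
      mul_le_mul_of_nonneg_left h1 (abs_nonneg l), mul_le_mul_of_nonneg_left h2 (abs_nonneg m),
      mul_nonneg (abs_nonneg l) (norm_nonneg z), mul_nonneg (abs_nonneg m) (norm_nonneg z)]
  · rw [norm_mul, hκ, one_mul, Complex.norm_real]
    exact abs_coord_le_norm ζ _

/-- Gaussian domination of the coherent states and their horizontal derivatives, uniform in time
and for frequencies in a compact set that avoids zero. -/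
theorem exists_wavePacket_domination {g : ℝ → ℝ} (hg : ContDiff ℝ ∞ g) (hgc : HasCompactSupport g)
    (hg0 : tsupport g ⊆ {0}ᶜ) (η : Plane n) : ∃ b > 0, ∃ C, ∀ σ z ν,
      ‖wavePacket g η σ (z, ν)‖ ≤
        (tsupport g).indicator (fun _ => C * Real.exp (-b * ‖z‖ ^ 2)) ν ∧
      (∀ j, ‖heisX j (fun p => (g ν : ℂ) * Complex.exp (coherentPhase η ν σ p)) (z, 0)‖ ≤
        (tsupport g).indicator (fun _ => C * Real.exp (-b * ‖z‖ ^ 2)) ν) ∧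
      ∀ j, ‖heisY j (fun p => (g ν : ℂ) * Complex.exp (coherentPhase η ν σ p)) (z, 0)‖ ≤
        (tsupport g).indicator (fun _ => C * Real.exp (-b * ‖z‖ ^ 2)) ν := by
  obtain ⟨G, hG⟩ := hgc.exists_bound_of_continuous hg.continuous
  have hG0 : 0 ≤ G := (norm_nonneg _).trans (hG 0)
  obtain ⟨R, hR⟩ := hgc.isCompact.isBounded.exists_norm_le
  have hδ : ∃ δ > 0, ∀ ν ∈ tsupport g, δ ≤ |ν| := by
    obtain ⟨δ, hδ, hb⟩ := Metric.isOpen_iff.1 (isClosed_tsupport g).isOpen_compl 0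
      (fun h => hg0 h rfl)
    refine ⟨δ, hδ, fun ν hν => ?_⟩
    by_contra h
    exact hb (by simpa using lt_of_not_ge h) hν
  obtain ⟨δ, hδ, hδν⟩ := hδ
  -- The exponent a‖z‖ collects ‖η‖‖z‖ from the coherent state and one ‖z‖ from a factor e^{‖z‖},
  -- which pays for the linear growth of the horizontal derivatives. As π > 3, the Gaussian decays
  -- at least like e^{-(3/2)δ‖z‖²}; half of δ absorbs a‖z‖ at the cost e^{a²/(2δ)}, and the rate δ
  -- is left.
  set a : ℝ := ‖η‖ + 1 with ha
  -- Here |l| + |m| = 4π|ν| ≤ 4π|R| on the support of g; the summand 1 gives A ≥ 1, so that the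
  -- undifferentiated state is covered too.
  set A : ℝ := 4 * Real.pi * |R| + ‖η‖ + 1 with hA
  have hA1 : 1 ≤ A := by rw [hA]; nlinarith [Real.pi_pos, abs_nonneg R, norm_nonneg η, mul_nonneg Real.pi_pos.le (abs_nonneg R)]
  refine ⟨δ, hδ, G * A * Real.exp (a ^ 2 / (2 * δ)), fun σ z ν => ?_⟩
  by_cases hν : ν ∈ tsupport g
  swap
  · have h0 := image_eq_zero_of_notMem_tsupport hν
    simp only [indicator_of_notMem hν]
    exact ⟨by simp [wavePacket, h0], fun j => by simp [heisX, h0], fun j => by simp [heisY, h0]⟩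
  simp only [indicator_of_mem hν]
  have hν0 : ν ≠ 0 := hg0 hν
  have hνR : |ν| ≤ |R| := (hR ν hν).trans (le_abs_self R)
  have hexp : ‖Complex.exp (coherentPhase η ν σ (z, 0))‖ * Real.exp ‖z‖ ≤
      Real.exp (a ^ 2 / (2 * δ)) * Real.exp (-δ * ‖z‖ ^ 2) := by
    refine (mul_le_mul_of_nonneg_right (norm_cexp_coherentPhase_le η hν0 σ z)
      (Real.exp_pos _).le).trans ?_
    rw [← Real.exp_add, ← Real.exp_add]
    refine Real.exp_le_exp.2 ?_
    have h1 : 3 / 2 * δ ≤ Real.pi / 2 * |ν| := by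
      have := Real.pi_gt_three
      have := hδν ν hν
      nlinarith
    have h2 : a ^ 2 / (2 * δ) - a * ‖z‖ + δ / 2 * ‖z‖ ^ 2 = (δ * ‖z‖ - a) ^ 2 / (2 * δ) := by
      field_simp
      ring
    have h3 : 0 ≤ (δ * ‖z‖ - a) ^ 2 / (2 * δ) := by positivity
    have h4 := mul_le_mul_of_nonneg_right h1 (sq_nonneg ‖z‖)
    rw [ha] at h2 h3 ⊢
    nlinarith
  have key : ∀ w : ℂ, ‖w‖ ≤ A * Real.exp ‖z‖ →
      ‖(g ν : ℂ) * (Complex.exp (coherentPhase η ν σ (z, 0)) * w)‖ ≤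
        G * A * Real.exp (a ^ 2 / (2 * δ)) * Real.exp (-δ * ‖z‖ ^ 2) := fun w hw => by
    rw [norm_mul, norm_mul, Complex.norm_real]
    calc ‖g ν‖ * (‖Complex.exp (coherentPhase η ν σ (z, 0))‖ * ‖w‖)
        ≤ G * (‖Complex.exp (coherentPhase η ν σ (z, 0))‖ * (A * Real.exp ‖z‖)) := by
          gcongr; exact hG ν
      _ = G * A * (‖Complex.exp (coherentPhase η ν σ (z, 0))‖ * Real.exp ‖z‖) := by ring
      _ ≤ G * A * (Real.exp (a ^ 2 / (2 * δ)) * Real.exp (-δ * ‖z‖ ^ 2)) := by gcongr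
      _ = _ := by ring
  have hlin : (|(-2 * Real.pi * ν)| + abs (2 * Real.pi * |ν|)) * ‖z‖ + ‖η‖ ≤ A * Real.exp ‖z‖ := by
    have h1 : |(-2 * Real.pi * ν)| + abs (2 * Real.pi * |ν|) = 4 * Real.pi * |ν| := by
      rw [abs_mul, abs_mul, abs_mul, abs_mul, abs_abs, abs_of_pos Real.pi_pos]
      norm_num
      ring
    rw [h1]
    have h2 := Real.add_one_le_exp ‖z‖
    have h3 : 4 * Real.pi * |ν| ≤ 4 * Real.pi * |R| := by gcongr
    calc 4 * Real.pi * |ν| * ‖z‖ + ‖η‖ ≤ 4 * Real.pi * |R| * ‖z‖ + ‖η‖ := by gcongr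
      _ ≤ A * (‖z‖ + 1) := by
          rw [hA]
          nlinarith [norm_nonneg z, norm_nonneg η, mul_nonneg Real.pi_pos.le (abs_nonneg R),
            mul_nonneg (norm_nonneg η) (norm_nonneg z)]
      _ ≤ _ := by gcongr
  have hκ : ‖Complex.I * Complex.exp (Complex.I * (2 * Real.pi * |ν| : ℝ) * σ)‖ = 1 := by
    rw [norm_mul, Complex.norm_I, one_mul, mul_assoc, ← Complex.ofReal_mul, mul_comm,
      Complex.norm_exp_ofReal_mul_I]
  refine ⟨?_, fun j => ?_, fun j => ?_⟩
  · have := key 1 (by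
      rw [norm_one]
      nlinarith [Real.add_one_le_exp ‖z‖, norm_nonneg z])
    simpa [wavePacket] using this
  · simp only [coherentPhase]
    rw [heisX_const_mul (contDiff_quadPhase _ _ _ _ _).cexp, heisX_cexp_quadPhase]
    refine key _ ((norm_quadPhaseX_le _ _ hκ _ _ _).trans ?_)
    rw [LinearIsometry.norm_map]
    exact hlin
  · simp only [coherentPhase]
    rw [heisY_const_mul (contDiff_quadPhase _ _ _ _ _).cexp, heisY_cexp_quadPhase]
    refine key _ ((norm_quadPhaseY_le _ _ hκ _ _ _).trans ?_)
    rw [LinearIsometry.norm_map]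
    exact hlin

end WavePacketEvolution

/-! ### Wave packets as test functions for the evolution -/

section WavePacketPairing

variable {n : ℕ} {g : ℝ → ℝ}

theorem contDiff_mul_cexp_coherentPhase_slice (hg : ContDiff ℝ ∞ g) (hg0 : tsupport g ⊆ {0}ᶜ)
    (η : Plane n) (σ : ℝ) : ContDiff ℝ ∞ fun q : Heis n × ℝ =>
      (g q.2 : ℂ) * Complex.exp (coherentPhase η q.2 σ q.1) := by
  have h := (contDiff_mul_cexp_coherentPhase hg hg0 η 0).comp
    (by fun_prop : ContDiff ℝ ∞ fun q : Heis n × ℝ => ((q.1, σ), q.2))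
  simpa [Function.comp_def] using h

theorem continuous_wavePacket (hg : ContDiff ℝ ∞ g) (hg0 : tsupport g ⊆ {0}ᶜ)
    (η : Plane n) (σ : ℝ) : Continuous (wavePacket g η σ) :=
  (contDiff_mul_cexp_coherentPhase_slice hg hg0 η σ).continuous.comp
    (by fun_prop : Continuous fun q : Plane n × ℝ => (((q.1, 0) : Heis n), q.2))

theorem memLp_wavePacket (hg : ContDiff ℝ ∞ g) (hgc : HasCompactSupport g)
    (hg0 : tsupport g ⊆ {0}ᶜ) (η : Plane n) (σ : ℝ) : MemLp (wavePacket g η σ) 2 := by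
  obtain ⟨b, hb, C, hC⟩ := exists_wavePacket_domination hg hgc hg0 η
  obtain ⟨M, -, hM⟩ := exists_bound_of_gaussian_domination n hgc.isCompact hb C
  exact (hM _ (continuous_wavePacket hg hg0 η σ) fun z ν => (hC σ z ν).1).1

theorem integrable_wavePacket_slice (hg : ContDiff ℝ ∞ g) (hgc : HasCompactSupport g)
    (hg0 : tsupport g ⊆ {0}ᶜ) (η : Plane n) (σ : ℝ) (z : Plane n) :
    Integrable fun ν => wavePacket g η σ (z, ν) := by
  obtain ⟨b, hb, C, hC⟩ := exists_wavePacket_domination hg hgc hg0 η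
  obtain ⟨M, -, hM⟩ := exists_bound_of_gaussian_domination n hgc.isCompact hb C
  exact (hM _ (continuous_wavePacket hg hg0 η σ) fun z ν => (hC σ z ν).1).2.1 z

theorem deriv_integral_coherentPhase (hg : ContDiff ℝ ∞ g) (hgc : HasCompactSupport g)
    (hg0 : tsupport g ⊆ {0}ᶜ) (η : Plane n) (τ : ℝ) (p : Heis n) (s : ℝ) :
    deriv (fun r => ∫ ν, (g ν : ℂ) * Complex.exp (coherentPhase η ν (r - τ) p)) s =
      -Complex.I * subLaplacian
        (fun q => ∫ ν, (g ν : ℂ) * Complex.exp (coherentPhase η ν (s - τ) q)) p := by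
  have hz : ∀ ν ∉ tsupport g, (g ν : ℂ) = 0 := fun ν hν => by
    rw [image_eq_zero_of_notMem_tsupport hν]; rfl
  have hF : ContDiff ℝ ∞ fun q : ℝ × ℝ =>
      (g q.2 : ℂ) * Complex.exp (coherentPhase η q.2 (q.1 - τ) p) :=
    (contDiff_mul_cexp_coherentPhase hg hg0 η τ).comp
      (by fun_prop : ContDiff ℝ ∞ fun q : ℝ × ℝ => ((p, q.1), q.2))
  have h1 := fderiv_integral_of_compact hF hgc.isCompact
    (fun r ν hν => by simp only [hz ν hν, zero_mul]) s 1
  have h2 := subLaplacian_integral_of_compact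
    (contDiff_mul_cexp_coherentPhase_slice hg hg0 η (s - τ)) hgc.isCompact
    (fun r ν hν => by simp only [hz ν hν, zero_mul]) p
  rw [← fderiv_apply_one_eq_deriv, h1, h2, ← integral_const_mul]
  refine integral_congr_ae (Filter.Eventually.of_forall fun ν => ?_)
  simp only [fderiv_apply_one_eq_deriv]
  have hE : ContDiff ℝ ∞ fun q => Complex.exp (coherentPhase η ν (s - τ) q) :=
    (contDiff_quadPhase _ _ _ _ _).cexp
  rw [subLaplacian_const_mul hE]
  by_cases hν : ν ∈ tsupport g
  · have h3 := ((hasDerivAt_cexp_coherentPhase η (hg0 hν) (s - τ) p).scomp s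
      ((hasDerivAt_id s).sub_const τ)).const_mul (g ν : ℂ)
    refine h3.deriv.trans ?_
    rw [one_smul, mul_left_comm]
  · simp [hz ν hν]

/-- The conserved pairing is taken with the packet at internal time s - τ, which is 0 when s = τ and
-τ when s = 0. Plancherel in t turns the Gaussian envelopes into the L² bounds that `pairing_eq`
needs. -/
theorem IsFreeSchrodingerSolution.pairing_wavePacket {u : ℝ → HeisL2 n}
    (hu : IsFreeSchrodingerSolution u) (hg : ContDiff ℝ ∞ g) (hgc : HasCompactSupport g)
    (hg0 : tsupport g ⊆ {0}ᶜ) (η : Plane n) {τ : ℝ} (hτ : 0 ≤ τ) :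
    ∫ p, u τ p * partialFourier (wavePacket g η 0) p =
      ∫ p, u 0 p * partialFourier (wavePacket g η (-τ)) p := by
  obtain ⟨b, hb, C, hC⟩ := exists_wavePacket_domination hg hgc hg0 η
  obtain ⟨M, hMt, hM⟩ := exists_bound_of_gaussian_domination n hgc.isCompact hb C
  have hz : ∀ ν ∉ tsupport g, (g ν : ℂ) = 0 := fun ν hν => by
    rw [image_eq_zero_of_notMem_tsupport hν]; rfl
  have hslice := contDiff_mul_cexp_coherentPhase_slice (n := n) hg hg0 η
  have hzero : ∀ σ, ∀ p : Heis n, ∀ ν ∉ tsupport g,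
      (g ν : ℂ) * Complex.exp (coherentPhase η ν σ p) = 0 := fun σ p ν hν => by
    rw [hz ν hν, zero_mul]
  set ψ : Heis n × ℝ → ℂ := fun q =>
    ∫ ν, (g ν : ℂ) * Complex.exp (coherentPhase η ν (q.2 - τ) q.1) with hψ
  have hsmooth : ContDiff ℝ ∞ ψ :=
    contDiff_integral_of_compact (contDiff_mul_cexp_coherentPhase hg hg0 η τ) hgc.isCompact
      fun q ν hν => hzero _ _ ν hν
  have hψ' : ∀ s, (fun p => ψ (p, s)) = partialFourier (wavePacket g η (s - τ)) := fun s =>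
    funext fun p => (partialFourier_wavePacket g η (s - τ) p).symm
  have hcont0 : Continuous fun q : Plane n × ℝ => (((q.1, 0) : Heis n), q.2) := by fun_prop
  have key := hu.pairing_eq hsmooth (deriv_integral_coherentPhase hg hgc hg0 η τ) hτ hMt
    (fun s _ => ?_) (fun s _ j => ?_) (fun s _ j => ?_)
  · have e1 := hψ' τ
    have e2 := hψ' 0
    rw [sub_self] at e1
    rw [zero_sub] at e2
    rw [← e1, ← e2]
    exact key
  · rw [hψ']
    obtain ⟨h1, h2, h3⟩ := hM _ (continuous_wavePacket hg hg0 η (s - τ)) fun z ν =>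
      (hC (s - τ) z ν).1
    rw [eLpNorm_partialFourier h1 (Filter.Eventually.of_forall h2)]
    exact h3
  · obtain ⟨h1, h2, h3⟩ := hM (fun q => heisX j (fun p => (g q.2 : ℂ) *
      Complex.exp (coherentPhase η q.2 (s - τ) p)) (q.1, 0))
      ((contDiff_heisX_slice (hslice (s - τ)) j).continuous.comp hcont0) fun z ν =>
      (hC (s - τ) z ν).2.1 j
    rw [← eLpNorm_partialFourier h1 (Filter.Eventually.of_forall h2)] at h3
    refine le_of_eq_of_le (congrArg (fun f => eLpNorm f 2 volume) ?_) h3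
    ext1 p
    rw [partialFourier_heisX_wavePacket]
    exact heisX_integral_of_compact (hslice (s - τ)) hgc.isCompact (hzero (s - τ)) j p
  · obtain ⟨h1, h2, h3⟩ := hM (fun q => heisY j (fun p => (g q.2 : ℂ) *
      Complex.exp (coherentPhase η q.2 (s - τ) p)) (q.1, 0))
      ((contDiff_heisY_slice (hslice (s - τ)) j).continuous.comp hcont0) fun z ν =>
      (hC (s - τ) z ν).2.2 j
    rw [← eLpNorm_partialFourier h1 (Filter.Eventually.of_forall h2)] at h3
    refine le_of_eq_of_le (congrArg (fun f => eLpNorm f 2 volume) ?_) h3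
    ext1 p
    rw [partialFourier_heisY_wavePacket]
    exact heisY_integral_of_compact (hslice (s - τ)) hgc.isCompact (hzero (s - τ)) j p

end WavePacketPairing

/-! ### Linear changes of variables -/

section LinearChangeOfVariables

variable {V : Type*} [NormedAddCommGroup V] [InnerProductSpace ℝ V] [FiniteDimensional ℝ V]
  [MeasurableSpace V] [BorelSpace V]

theorem LinearEquiv.map_volume_eq_smul (B : V ≃ₗ[ℝ] V) : ∃ c : ℝ≥0∞, c ≠ 0 ∧ c ≠ ⊤ ∧
    (volume : Measure V).map B = c • volume := by
  have hdet : LinearMap.det (B : V →ₗ[ℝ] V) ≠ 0 := B.isUnit_det'.ne_zero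
  refine ⟨_, ?_, ENNReal.ofReal_ne_top,
    Measure.map_linearMap_addHaar_eq_smul_addHaar (volume : Measure V) hdet⟩
  simpa using hdet

theorem LinearEquiv.quasiMeasurePreserving_volume (B : V ≃ₗ[ℝ] V) :
    Measure.QuasiMeasurePreserving B (volume : Measure V) volume := by
  obtain ⟨c, -, -, hc⟩ := B.map_volume_eq_smul
  refine ⟨B.toContinuousLinearEquiv.continuous.measurable, ?_⟩
  rw [hc]
  exact Measure.smul_absolutelyContinuous

theorem memLp_comp_linearEquiv (B : V ≃ₗ[ℝ] V) {f : V → ℂ} (hf : MemLp f 2) :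
    MemLp (fun z => f (B z)) 2 := by
  obtain ⟨c, -, hct, hc⟩ := B.map_volume_eq_smul
  have hB : AEMeasurable B (volume : Measure V) := B.quasiMeasurePreserving_volume.aemeasurable
  have h := hf.smul_measure hct
  rw [← hc] at h
  exact (memLp_map_measure_iff h.1 hB).1 h

theorem exists_integral_comp_linearEquiv (B : V ≃ₗ[ℝ] V) :
    ∃ c : ℝ, c ≠ 0 ∧ ∀ f : V → ℂ, ∫ z, f (B z) = c * ∫ z, f z := by
  obtain ⟨c, hc0, hct, hc⟩ := B.map_volume_eq_smul
  refine ⟨c.toReal, (ENNReal.toReal_pos hc0 hct).ne', fun f => ?_⟩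
  have h := integral_map_equiv (μ := (volume : Measure V))
    B.toContinuousLinearEquiv.toHomeomorph.toMeasurableEquiv f
  have h2 : ∫ y, f y ∂(volume : Measure V).map B = ∫ z, f (B z) := h
  rw [← h2, hc, integral_smul_measure, Complex.real_smul]

end LinearChangeOfVariables

/-! ### The Mehler formula at a fixed frequency -/

section FixedFrequency

variable {n : ℕ}

theorem norm_cexp_gaussian_wave (b : ℂ) (η z : Plane n) :
    ‖Complex.exp (-b * ((‖z‖ ^ 2 : ℝ) : ℂ) + Complex.I * ((inner ℝ η z : ℝ) : ℂ))‖ =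
      Real.exp (-b.re * ‖z‖ ^ 2) := by
  rw [Complex.norm_exp]
  congr 1
  rw [Complex.add_re, Complex.mul_re, Complex.ofReal_im, Complex.mul_re, Complex.ofReal_im,
    Complex.ofReal_re, Complex.I_re]
  simp

theorem memLp_gaussian_wave {b : ℂ} (hb : 0 < b.re) (η : Plane n) :
    MemLp (fun z : Plane n => Complex.exp (-b * ((‖z‖ ^ 2 : ℝ) : ℂ) +
      Complex.I * ((inner ℝ η z : ℝ) : ℂ))) 2 := by
  refine (memLp_gaussian_plane hb).mono (by fun_prop) (Filter.Eventually.of_forall fun z => ?_)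
  rw [norm_cexp_gaussian_wave]
  exact Real.le_norm_self _

theorem integrable_gaussian_wave {b : ℂ} (hb : 0 < b.re) (η : Plane n) :
    Integrable (fun z : Plane n => Complex.exp (-b * ((‖z‖ ^ 2 : ℝ) : ℂ) +
      Complex.I * ((inner ℝ η z : ℝ) : ℂ))) := by
  refine (integrable_gaussian_plane hb).mono (by fun_prop) (Filter.Eventually.of_forall fun z => ?_)
  rw [norm_cexp_gaussian_wave]
  exact Real.le_norm_self _

/-- The modulated Gaussians, for a dense set of modulations, are total in `L²`. -/
theorem ae_eq_zero_of_integral_gaussian_wave {f : Plane n → ℂ} (hf : MemLp f 2) {b : ℂ}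
    (hb : 0 < b.re) {D : Set (Plane n)} (hD : Dense D)
    (h : ∀ η ∈ D, ∫ z, f z * Complex.exp (-b * ((‖z‖ ^ 2 : ℝ) : ℂ) +
      Complex.I * ((inner ℝ η z : ℝ) : ℂ)) = 0) : f =ᵐ[volume] 0 := by
  set F : Plane n → ℂ := fun z => f z * Complex.exp (-b * ((‖z‖ ^ 2 : ℝ) : ℂ) +
      Complex.I * ((inner ℝ (0 : Plane n) z : ℝ) : ℂ)) with hF
  have hFi : Integrable F := MemLp.integrable_mul hf (memLp_gaussian_wave hb 0)
  have hcont : Continuous (𝓕 F) :=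
    VectorFourier.fourierIntegral_continuous Real.continuous_fourierChar continuous_inner hFi
  -- The pairings are values of the Fourier transform of f times a Gaussian. This transform is
  -- continuous, so vanishing for η in D extends to all η, and the Gaussian never vanishes.
  have hval : ∀ η : Plane n, 𝓕 F ((-(2 * Real.pi)⁻¹) • η) =
      ∫ z, f z * Complex.exp (-b * ((‖z‖ ^ 2 : ℝ) : ℂ) + Complex.I * ((inner ℝ η z : ℝ) : ℂ)) := by
    intro η
    rw [Real.fourier_eq']
    refine integral_congr_ae (Filter.Eventually.of_forall fun z => ?_)
    simp only [hF, smul_eq_mul]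
    rw [mul_left_comm, ← Complex.exp_add]
    congr 2
    rw [inner_smul_right, inner_zero_left, real_inner_comm]
    push_cast
    have : (Real.pi : ℂ) ≠ 0 := by exact_mod_cast Real.pi_ne_zero
    field_simp
    ring
  have hz : (fun η : Plane n => 𝓕 F ((-(2 * Real.pi)⁻¹) • η)) = fun _ => 0 :=
    Continuous.ext_on hD (hcont.comp (continuous_const_smul _)) continuous_const
      fun η hη => (hval η).trans (h η hη)
  have hF0 : F =ᵐ[volume] 0 := ae_eq_zero_of_fourier_eq_zero hFi fun ξ => by
    have := congrFun hz ((-(2 * Real.pi)) • ξ)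
    simp only [smul_smul] at this
    rwa [neg_mul_neg, inv_mul_cancel₀ (by positivity), one_smul] at this
  filter_upwards [hF0] with z hz'
  exact (mul_eq_zero.1 hz').resolve_right (Complex.exp_ne_zero _)

theorem coherentPhase_time_zero (η : Plane n) (ν : ℝ) (z : Plane n) :
    coherentPhase η ν 0 (z, 0) = -((Real.pi / 2 * |ν| : ℝ) : ℂ) * ((‖z‖ ^ 2 : ℝ) : ℂ) +
      Complex.I * ((inner ℝ η z : ℝ) : ℂ) := by
  have h : planeRot n 0 η = η := by simp [planeRot_apply]
  simp only [coherentPhase, quadPhase, h, Complex.ofReal_zero, mul_zero, Complex.exp_zero, sub_self,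
    zero_div, add_zero, zero_sub, mul_one]
  push_cast
  ring

/-- At a fixed frequency the propagator is, up to quadratic phases, a Fourier transform composed
with an invertible linear map, so the annihilating property applies. -/
theorem ae_eq_zero_of_coherent_pairing {S W : Set (Plane n)}
    (hSW : ∀ T : Plane n ≃ₗ[ℝ] Plane n, IsWeakAnnihilatingPair S (T '' W))
    {ν τ : ℝ} (hν : ν ≠ 0) (hsin : Real.sin (2 * Real.pi * |ν| * τ) ≠ 0) {f₀ f₁ : Plane n → ℂ}
    (hf₀ : MemLp f₀ 2) (hf₁ : MemLp f₁ 2) (h₀ : ∀ᵐ z, z ∉ S → f₀ z = 0)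
    (h₁ : ∀ᵐ z, z ∉ W → f₁ z = 0) {D : Set (Plane n)} (hD : Dense D)
    (h : ∀ η ∈ D, ∫ z, f₁ z * Complex.exp (coherentPhase η ν 0 (z, 0)) =
      ∫ z, f₀ z * Complex.exp (coherentPhase η ν (-τ) (z, 0))) : f₀ =ᵐ[volume] 0 := by
  set m : ℝ := 2 * Real.pi * |ν| with hm
  have hmpos : 0 < m := by positivity
  set s : ℝ := Real.sin (m * τ) with hs
  set c : ℝ := Real.cos (m * τ) with hc
  -- The chirp rate and the scale k of the Mehler kernel at time τ; both need sin(mτ) ≠ 0.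
  set γ : ℝ := m * c / (4 * s) with hγ
  set k : ℝ := m / (4 * Real.pi * s) with hk
  have hpi : Real.pi ≠ 0 := Real.pi_ne_zero
  have hk0 : k ≠ 0 := by rw [hk]; positivity
  set R : Plane n →ₗᵢ[ℝ] Plane n := planeRot n (-2 * Real.pi * ν * -τ) with hR
  let B : Plane n ≃ₗ[ℝ] Plane n := (R.toLinearIsometryEquiv rfl).toLinearEquiv.trans
    (LinearEquiv.smulOfNeZero ℝ (Plane n) k hk0)
  have hB : ∀ z, B z = k • R z := fun z => rfl
  obtain ⟨d, hd0, hd⟩ := exists_integral_comp_linearEquiv B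
  have hsc : (s : ℂ) ^ 2 + (c : ℂ) ^ 2 = 1 := by exact_mod_cast Real.sin_sq_add_cos_sq (m * τ)
  have hs' : (s : ℂ) ≠ 0 := by exact_mod_cast hsin
  have hm' : (m : ℂ) ≠ 0 := by exact_mod_cast hmpos.ne'
  have hpi' : (Real.pi : ℂ) ≠ 0 := by exact_mod_cast hpi
  set E : ℂ := c - Complex.I * s with hE
  have hEne : E ≠ 0 := fun h0 => by
    have : (c - Complex.I * s : ℂ) * (c + Complex.I * s) = 1 := by
      linear_combination hsc - (s : ℂ) ^ 2 * Complex.I_sq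
    rw [← hE, h0, zero_mul] at this
    exact zero_ne_one this
  have hexpE : Complex.exp (Complex.I * (m : ℂ) * ((-τ : ℝ) : ℂ)) = E := by
    rw [show Complex.I * (m : ℂ) * ((-τ : ℝ) : ℂ) = ((-(m * τ) : ℝ) : ℂ) * Complex.I by
      push_cast; ring, Complex.exp_mul_I, ← Complex.ofReal_cos, ← Complex.ofReal_sin, Real.cos_neg,
      Real.sin_neg, ← hs, ← hc, hE, Complex.ofReal_neg]
    ring
  -- Chosen so that a|Bz|² = (m/4 - iγ)|z|²: the chirp times the time-zero Gaussian becomes a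
  -- Gaussian in Bz. Its transform has the exponent coefficient π²/a = imE/(4s) with E = e^{-imτ},
  -- as the coherent state at time -τ requires.
  set a : ℂ := ((m / 4 : ℝ) - Complex.I * γ) / ((k ^ 2 : ℝ) : ℂ) with ha
  have hare : 0 < a.re := by
    rw [ha, Complex.div_ofReal_re]
    simp
    positivity
  have ha0 : a ≠ 0 := fun h0 => by simp [h0] at hare
  have hainv : (Real.pi : ℂ) ^ 2 / a = Complex.I * m * E / (4 * s) := by
    have hk' : (k : ℂ) = m / (4 * Real.pi * s) := by rw [hk]; push_cast; ring
    have hγ' : (γ : ℂ) = m * c / (4 * s) := by rw [hγ]; push_cast; ring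
    have ha' : a * (Complex.I * E) = 4 * Real.pi ^ 2 * s / m := by
      rw [ha, hE]
      push_cast
      rw [hk', hγ']
      field_simp
      linear_combination hsc + (Complex.I * s * c - s ^ 2 - c ^ 2) * Complex.I_sq
    rw [div_eq_iff ha0, show Complex.I * m * E / (4 * s) * a = a * (Complex.I * E) * m / (4 * s) by
      ring, ha']
    field_simp
  have hak : a * ((k ^ 2 : ℝ) : ℂ) = (m / 4 : ℝ) - Complex.I * γ := by
    rw [ha, div_mul_cancel₀]
    exact_mod_cast pow_ne_zero 2 hk0
  have hγE : -(Complex.I * m * E / (4 * s)) + Complex.I * γ = -((m / 4 : ℝ) : ℂ) := by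
    rw [hγ, hE]
    push_cast
    field_simp
    linear_combination (s : ℂ) * Complex.I_sq
  have hEsq : E ^ 2 - 1 = -2 * Complex.I * s * E := by
    rw [hE]
    linear_combination hsc - (s : ℂ) ^ 2 * Complex.I_sq
  set v : Plane n → ℂ := fun w => Complex.exp (Complex.I * γ * ((‖w‖ ^ 2 : ℝ) : ℂ)) * f₀ w with hvdef
  have hphase : ∀ w : Plane n, ‖Complex.exp (Complex.I * γ * ((‖w‖ ^ 2 : ℝ) : ℂ))‖ = 1 := fun w => by
    rw [mul_assoc, ← Complex.ofReal_mul, mul_comm, Complex.norm_exp_ofReal_mul_I]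
  have hcphase : Continuous fun w : Plane n => Complex.exp (Complex.I * γ * ((‖w‖ ^ 2 : ℝ) : ℂ)) := by
    fun_prop
  have hphaseMul : ∀ f : Plane n → ℂ, MemLp f 2 →
      MemLp (fun w => Complex.exp (Complex.I * γ * ((‖w‖ ^ 2 : ℝ) : ℂ)) * f w) 2 := fun f hf =>
    hf.congr_norm (hcphase.aestronglyMeasurable.mul hf.1)
      (Filter.Eventually.of_forall fun w => by rw [norm_mul, hphase, one_mul])
  have hv : MemLp v 2 := hphaseMul f₀ hf₀
  set Fv : Lp ℂ 2 (volume : Measure (Plane n)) := 𝓕 (hv.toLp v) with hFv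
  set A : ℂ := (Real.pi / a) ^ (Module.finrank ℝ (Plane n) / 2 : ℂ) with hA
  have hA0 : A ≠ 0 := fun h0 => by
    rw [hA, Complex.cpow_eq_zero_iff] at h0
    exact div_ne_zero hpi' ha0 h0.1
  have hd0' : (d : ℂ) ≠ 0 := by exact_mod_cast hd0
  -- The numerator is the factor e^{inmσ} of the coherent state at σ = -τ; d is the Jacobian factor
  -- of B and A the constant of the Gaussian transform.
  set Cst : ℂ := Complex.exp (Complex.I * n * m * ((-τ : ℝ) : ℂ)) / (d * A) with hCst
  have hCst0 : Cst ≠ 0 := div_ne_zero (Complex.exp_ne_zero _) (mul_ne_zero hd0' hA0)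
  have hCstA : Cst * d * A = Complex.exp (Complex.I * n * m * ((-τ : ℝ) : ℂ)) := by
    rw [hCst]; field_simp
  -- The Mehler propagator applied to f₀. It has the same pairings with modulated Gaussians as f₁,
  -- so it equals f₁ by totality.
  set f₂ : Plane n → ℂ := fun z =>
    Cst * (Complex.exp (Complex.I * γ * ((‖z‖ ^ 2 : ℝ) : ℂ)) * Fv (B z)) with hf₂def
  have hf₂ : MemLp f₂ 2 :=
    (hphaseMul _ (memLp_comp_linearEquiv B (Lp.memLp Fv))).const_mul Cst
  have hpair : ∀ η : Plane n, ∫ z, f₂ z * Complex.exp (coherentPhase η ν 0 (z, 0)) =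
      ∫ z, f₀ z * Complex.exp (coherentPhase η ν (-τ) (z, 0)) := by
    intro η
    -- Scaled so that 2π⟨x, Bz⟩ = ⟨η, z⟩.
    set x : Plane n := (2 * s / m) • R η with hx
    set H : Plane n → ℂ := fun ξ =>
      Complex.exp (-a * (‖ξ‖ : ℂ) ^ 2 + 2 * Real.pi * Complex.I * ((inner ℝ x ξ : ℝ) : ℂ)) with hH
    have hH' : H = fun ξ => Complex.exp (-a * ((‖ξ‖ ^ 2 : ℝ) : ℂ) +
        Complex.I * ((inner ℝ ((2 * Real.pi) • x) ξ : ℝ) : ℂ)) := by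
      ext1 ξ
      rw [hH, real_inner_smul_left]
      push_cast
      congr 1
      ring
    have hH1 : Integrable H := by rw [hH']; exact integrable_gaussian_wave hare _
    have hH2 : MemLp H 2 := by rw [hH']; exact memLp_gaussian_wave hare _
    have hFH : ∀ w, 𝓕 H w = A * Complex.exp (-Real.pi ^ 2 * ‖x - w‖ ^ 2 / a) := fun w =>
      fourier_gaussian_innerProductSpace' hare x w
    have hl : ∀ z, f₂ z * Complex.exp (coherentPhase η ν 0 (z, 0)) =
        Cst * (fun ξ => Fv ξ * H ξ) (B z) := by
      intro z
      have hBn : ‖B z‖ ^ 2 = k ^ 2 * ‖z‖ ^ 2 := by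
        rw [hB, norm_smul, R.norm_map, mul_pow, Real.norm_eq_abs, sq_abs]
      have hBi : inner ℝ ((2 * Real.pi) • x) (B z) = inner ℝ η z := by
        rw [hB, hx, real_inner_smul_left, real_inner_smul_left, real_inner_smul_right,
          R.inner_map_map, hk]
        field_simp
        ring
      have hphases : Complex.exp (Complex.I * γ * ((‖z‖ ^ 2 : ℝ) : ℂ)) *
          Complex.exp (coherentPhase η ν 0 (z, 0)) = H (B z) := by
        rw [hH', coherentPhase_time_zero, ← Complex.exp_add]
        simp only []
        rw [hBn, hBi, show Real.pi / 2 * |ν| = m / 4 by rw [hm]; ring, Complex.ofReal_mul]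
        congr 1
        linear_combination ((‖z‖ ^ 2 : ℝ) : ℂ) * hak
      simp only [hf₂def]
      rw [← hphases]
      ring
    simp_rw [hl]
    have hdG : ∫ z, Fv (B z) * H (B z) = d * ∫ ξ, Fv ξ * H ξ := hd fun ξ => Fv ξ * H ξ
    rw [integral_const_mul, hdG, hFv, integral_fourier_Lp_mul _ hH1 hH2]
    simp_rw [hFH]
    rw [← mul_assoc, ← integral_const_mul]
    refine integral_congr_ae ?_
    filter_upwards [hv.coeFn_toLp] with w hw
    have hxw : ‖x - w‖ ^ 2 =
        4 * s ^ 2 / m ^ 2 * ‖η‖ ^ 2 - 4 * s / m * inner ℝ (R η) w + ‖w‖ ^ 2 := by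
      rw [norm_sub_sq_real, hx, norm_smul, real_inner_smul_left, R.norm_map, mul_pow,
        Real.norm_eq_abs, sq_abs]
      field_simp
      ring
    have hexp : Complex.exp (Complex.I * n * m * ((-τ : ℝ) : ℂ)) *
        (Complex.exp (Complex.I * γ * ((‖w‖ ^ 2 : ℝ) : ℂ)) *
          Complex.exp (-Real.pi ^ 2 * ‖x - w‖ ^ 2 / a)) =
        Complex.exp (coherentPhase η ν (-τ) (w, 0)) := by
      rw [← Complex.exp_add, ← Complex.exp_add]
      congr 1
      simp only [coherentPhase, quadPhase]
      rw [← hm, ← hR, hexpE, show (2 : ℂ) * (Complex.I * (m : ℂ) * ((-τ : ℝ) : ℂ)) =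
        (2 : ℕ) * (Complex.I * (m : ℂ) * ((-τ : ℝ) : ℂ)) by norm_num, Complex.exp_nat_mul, hexpE,
        hEsq, show -(Real.pi : ℂ) ^ 2 * (‖x - w‖ : ℂ) ^ 2 / a =
          -(Real.pi ^ 2 / a) * ((‖x - w‖ ^ 2 : ℝ) : ℂ) by push_cast; ring, hainv, hxw]
      have hdist : Complex.I * m * E / (4 * s) * ((4 * s ^ 2 / m ^ 2 * ‖η‖ ^ 2 -
          4 * s / m * inner ℝ (R η) w + ‖w‖ ^ 2 : ℝ) : ℂ) =
          Complex.I * s * E / m * ((‖η‖ ^ 2 : ℝ) : ℂ) -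
          Complex.I * E * ((inner ℝ (R η) w : ℝ) : ℂ) +
          Complex.I * m * E / (4 * s) * ((‖w‖ ^ 2 : ℝ) : ℂ) := by
        push_cast
        field_simp
      rw [neg_mul, hdist]
      push_cast at hγE ⊢
      linear_combination ((‖w‖ : ℂ) ^ 2) * hγE
    rw [hw, hvdef, ← hexp, ← hCstA]
    ring
  have hae : (fun z => f₁ z - f₂ z) =ᵐ[volume] 0 := by
    refine ae_eq_zero_of_integral_gaussian_wave (hf₁.sub hf₂) (b := ((Real.pi / 2 * |ν| : ℝ) : ℂ))
      (by rw [Complex.ofReal_re]; positivity) hD fun η hη => ?_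
    have hgw := memLp_gaussian_wave (n := n) (b := ((Real.pi / 2 * |ν| : ℝ) : ℂ))
      (by rw [Complex.ofReal_re]; positivity) η
    have e1 := h η hη
    rw [← hpair η] at e1
    simp_rw [coherentPhase_time_zero] at e1
    simp only [sub_mul]
    have i1 := MemLp.integrable_mul hf₁ hgw
    have i2 := MemLp.integrable_mul hf₂ hgw
    exact (integral_sub i1 i2).trans (sub_eq_zero.2 e1)
  have hFvW : ∀ᵐ z, z ∉ W → Fv (B z) = 0 := by
    filter_upwards [hae, h₁] with z hz hz1 hzW
    have e : f₁ z - f₂ z = 0 := hz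
    rw [hz1 hzW, zero_sub, neg_eq_zero] at e
    exact ((mul_eq_zero.1 e).resolve_left hCst0 |> mul_eq_zero.1).resolve_left
      (Complex.exp_ne_zero _)
  have hv0 : hv.toLp v = 0 := by
    -- The chirp has modulus one, so v vanishes off S with f₀; and `Fv` composed with B vanishes off
    -- W with f₁, so `Fv` vanishes off B(W).
    refine hSW B _ ?_ ?_
    · filter_upwards [hv.coeFn_toLp, h₀] with z hz hz0 hzS
      rw [hz, hvdef]
      simp [hz0 hzS]
    · filter_upwards [B.symm.quasiMeasurePreserving_volume.ae hFvW] with ξ hξ hξW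
      have hξ' := hξ fun hmem => hξW ⟨B.symm ξ, hmem, B.apply_symm_apply ξ⟩
      rwa [B.apply_symm_apply] at hξ'
  have hv0' : v =ᵐ[volume] 0 := by
    have := hv.coeFn_toLp
    rw [hv0] at this
    exact this.symm.trans (Lp.coeFn_zero _ _ _)
  filter_upwards [hv0'] with z hz
  exact (mul_eq_zero.1 hz).resolve_left (Complex.exp_ne_zero _)

end FixedFrequency

/-! ### Localisation to single frequencies -/

section FrequencySlices

theorem ae_ae_swap_of_ae {X : Type*} [MeasureSpace X] [SFinite (volume : Measure X)]
    {P : X × ℝ → Prop} (h : ∀ᵐ p, P p) : ∀ᵐ t : ℝ, ∀ᵐ z : X, P (z, t) :=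
  Measure.ae_ae_of_ae_prod
    ((Measure.measurePreserving_swap (μ := (volume : Measure ℝ))
      (ν := (volume : Measure X))).quasiMeasurePreserving.ae h)

theorem integral_mul_eq_zero_of_slices {X : Type*} [MeasureSpace X] [SFinite (volume : Measure X)]
    (V : Lp ℂ 2 (volume : Measure (X × ℝ))) (hV : ∀ᵐ ν : ℝ, (fun z => V (z, ν)) =ᵐ[volume] 0)
    {a : X × ℝ → ℂ} (ha : MemLp a 2) : ∫ p, V p * a p = 0 := by
  have h1 := integral_prod_symm _ (integrable_mul_of_memLp V ha)
  refine h1.trans (integral_eq_zero_of_ae ?_)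
  filter_upwards [hV] with ν hν
  refine integral_eq_zero_of_ae ?_
  filter_upwards [hν] with z hz
  have hz' : V (z, ν) = 0 := hz
  simp [hz']

variable {n : ℕ}

theorem integrable_wavePacket_pairing (U : HeisL2 n) {g : ℝ → ℝ} (hg : ContDiff ℝ ∞ g)
    (hgc : HasCompactSupport g) (hg0 : tsupport g ⊆ {0}ᶜ) (η : Plane n) (σ : ℝ) :
    Integrable fun ν => g ν • ∫ z, U (z, ν) * Complex.exp (coherentPhase η ν σ (z, 0)) := by
  have h := (integrable_mul_of_memLp U (memLp_wavePacket hg hgc hg0 η σ)).integral_prod_right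
  refine h.congr (Filter.Eventually.of_forall fun ν => ?_)
  simp only [wavePacket, Complex.real_smul]
  rw [← integral_const_mul]
  refine integral_congr_ae (Filter.Eventually.of_forall fun z => ?_)
  simp only []
  ring

theorem integral_mul_wavePacket (U : HeisL2 n) {g : ℝ → ℝ} (hg : ContDiff ℝ ∞ g)
    (hgc : HasCompactSupport g) (hg0 : tsupport g ⊆ {0}ᶜ) (η : Plane n) (σ : ℝ) :
    ∫ p, U p * wavePacket g η σ p =
      ∫ ν, g ν • ∫ z, U (z, ν) * Complex.exp (coherentPhase η ν σ (z, 0)) := by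
  have h := integral_prod_symm _ (integrable_mul_of_memLp U (memLp_wavePacket hg hgc hg0 η σ))
  refine h.trans (integral_congr_ae (Filter.Eventually.of_forall fun ν => ?_))
  simp only [wavePacket, Complex.real_smul]
  rw [← integral_const_mul]
  refine integral_congr_ae (Filter.Eventually.of_forall fun z => ?_)
  simp only []
  ring

theorem locallyIntegrableOn_slice_pairing (U : HeisL2 n) (η : Plane n) (σ : ℝ) :
    LocallyIntegrableOn
      (fun ν => ∫ z, U (z, ν) * Complex.exp (coherentPhase η ν σ (z, 0))) {0}ᶜ := by
  intro x hx
  have hx0 : 0 < |x| := abs_pos.2 hx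
  let b : ContDiffBump x := ⟨|x| / 4, |x| / 2, by positivity, by linarith⟩
  have hb0 : tsupport b ⊆ {0}ᶜ := by
    rw [b.tsupport_eq]
    intro y hy hy0
    rw [mem_singleton_iff] at hy0
    rw [hy0, Metric.mem_closedBall, dist_zero_left, Real.norm_eq_abs] at hy
    have : b.rOut = |x| / 2 := rfl
    linarith
  have h := integrable_wavePacket_pairing U b.contDiff b.hasCompactSupport hb0 η σ
  refine ⟨Metric.closedBall x b.rIn, mem_nhdsWithin_of_mem_nhds
    (Metric.closedBall_mem_nhds x b.rIn_pos), ?_⟩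
  refine h.integrableOn.congr_fun (fun ν hν => ?_) measurableSet_closedBall
  simp only [b.one_of_mem_closedBall hν, one_smul]

/-- By Fubini each pairing is the integral of g against a function of ν that is locally integrable
off 0. Since g is arbitrary there, the two functions agree almost everywhere. -/
theorem ae_slice_pairing_eq {U₁ U₀ : HeisL2 n} {η : Plane n} {σ₁ σ₀ : ℝ}
    (h : ∀ g : ℝ → ℝ, ContDiff ℝ ∞ g → HasCompactSupport g → tsupport g ⊆ {0}ᶜ →
      ∫ p, U₁ p * wavePacket g η σ₁ p = ∫ p, U₀ p * wavePacket g η σ₀ p) :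
    ∀ᵐ ν : ℝ, ν ≠ 0 → ∫ z, U₁ (z, ν) * Complex.exp (coherentPhase η ν σ₁ (z, 0)) =
      ∫ z, U₀ (z, ν) * Complex.exp (coherentPhase η ν σ₀ (z, 0)) := by
  have key := isOpen_compl_singleton.ae_eq_zero_of_integral_contDiff_smul_eq_zero
    ((locallyIntegrableOn_slice_pairing U₁ η σ₁).sub (locallyIntegrableOn_slice_pairing U₀ η σ₀))
    fun g hg hgc hg0 => by
      have h1 := h g hg hgc hg0
      rw [integral_mul_wavePacket U₁ hg hgc hg0, integral_mul_wavePacket U₀ hg hgc hg0] at h1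
      simp only [Pi.sub_apply, smul_sub]
      rw [integral_sub (integrable_wavePacket_pairing U₁ hg hgc hg0 η σ₁)
        (integrable_wavePacket_pairing U₀ hg hgc hg0 η σ₀), h1, sub_self]
  filter_upwards [key] with ν hν hν0
  exact sub_eq_zero.1 (hν hν0)

theorem ae_sin_ne_zero {τ : ℝ} (hτ : 0 < τ) : ∀ᵐ ν : ℝ, Real.sin (2 * Real.pi * |ν| * τ) ≠ 0 := by
  have hc : (⋃ k : ℤ, ({(k : ℝ) / (2 * τ), -((k : ℝ) / (2 * τ))} : Set ℝ)).Countable :=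
    countable_iUnion fun k => (Set.toFinite _).countable
  filter_upwards [hc.ae_notMem volume] with ν hν hsin
  obtain ⟨k, hk⟩ := Real.sin_eq_zero_iff.1 hsin
  refine hν (mem_iUnion.2 ⟨k, ?_⟩)
  have habs : |ν| = k / (2 * τ) := by
    rw [eq_div_iff (by positivity)]
    have := Real.pi_pos
    have h2 : Real.pi * (|ν| * (2 * τ)) = Real.pi * k := by linarith
    exact mul_left_cancel₀ this.ne' h2
  rw [← habs]
  rcases abs_choice ν with h | h <;> rw [h] <;> simp

end FrequencySlices

/-! ### Vanishing of the initial datum, then of the solution -/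

theorem theorem3 (n : ℕ) (S W : Set (Plane n))
    (hS : NullMeasurableSet S volume) (hW : NullMeasurableSet W volume)
    (hSW : ∀ T : Plane n ≃ₗ[ℝ] Plane n, IsWeakAnnihilatingPair S (T '' W))
    (u : ℝ → HeisL2 n) (hu : IsFreeSchrodingerSolution u)
    (h0 : ∀ᵐ p : Heis n, p.1 ∉ S → u 0 p = 0)
    (s₀ : ℝ) (hs₀ : 0 < s₀)
    (h1 : ∀ᵐ p : Heis n, p.1 ∉ W → u s₀ p = 0) :
    ∀ s : ℝ, 0 ≤ s → u s = 0 := by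
  obtain ⟨U₀, hU₀S, hU₀⟩ := exists_partialFourier_dual_of_support (u 0) hS h0
  obtain ⟨U₁, hU₁W, hU₁⟩ := exists_partialFourier_dual_of_support (u s₀) hW h1
  -- The null set of bad frequencies depends on η, so only countably many η are used.
  set D : Set (Plane n) := range (TopologicalSpace.denseSeq (Plane n)) with hD
  have hDd : Dense D := TopologicalSpace.denseRange_denseSeq (Plane n)
  have hpair : ∀ τ : ℝ, 0 ≤ τ → ∀ V : HeisL2 n, (∀ a : Heis n → ℂ, MemLp a 2 →
      (∀ᵐ z, Integrable fun ν => a (z, ν)) → ∫ p, u τ p * partialFourier a p = ∫ p, V p * a p) →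
      ∀ η : Plane n, ∀ g : ℝ → ℝ, ContDiff ℝ ∞ g → HasCompactSupport g → tsupport g ⊆ {0}ᶜ →
      ∫ p, V p * wavePacket g η 0 p = ∫ p, U₀ p * wavePacket g η (-τ) p := by
    intro τ hτ V hV η g hg hgc hg0
    rw [← hV _ (memLp_wavePacket hg hgc hg0 η 0)
        (Filter.Eventually.of_forall (integrable_wavePacket_slice hg hgc hg0 η 0)),
      ← hU₀ _ (memLp_wavePacket hg hgc hg0 η (-τ))
        (Filter.Eventually.of_forall (integrable_wavePacket_slice hg hgc hg0 η (-τ)))]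
    exact hu.pairing_wavePacket hg hgc hg0 η hτ
  have hne : ∀ᵐ ν : ℝ, ν ≠ 0 := (countable_singleton (0 : ℝ)).ae_notMem volume
  have hzero₀ : ∀ᵐ ν : ℝ, (fun z => U₀ (z, ν)) =ᵐ[volume] 0 := by
    have hall : ∀ᵐ ν : ℝ, ∀ i : ℕ, ν ≠ 0 →
        ∫ z, U₁ (z, ν) * Complex.exp
          (coherentPhase (TopologicalSpace.denseSeq (Plane n) i) ν 0 (z, 0)) =
        ∫ z, U₀ (z, ν) * Complex.exp
          (coherentPhase (TopologicalSpace.denseSeq (Plane n) i) ν (-s₀) (z, 0)) :=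
      ae_all_iff.2 fun i => ae_slice_pairing_eq (hpair s₀ hs₀.le U₁ hU₁ _)
    filter_upwards [hall, hne, ae_sin_ne_zero hs₀, (Lp.memLp U₀).prodMk_right_ae,
      (Lp.memLp U₁).prodMk_right_ae, ae_ae_swap_of_ae hU₀S, ae_ae_swap_of_ae hU₁W]
      with ν hν hν0 hsin m₀ m₁ s₀' s₁'
    refine ae_eq_zero_of_coherent_pairing hSW hν0 hsin m₀ m₁ s₀' s₁' hDd ?_
    rintro _ ⟨i, rfl⟩
    exact hν i hν0
  intro τ hτ
  obtain ⟨V, hV⟩ := exists_partialFourier_dual (u τ)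
  -- Uniqueness: the slices of U₀ vanish, so conservation makes every pairing of V with a time-zero
  -- packet zero. No condition on sin(2π|ν|τ) enters, so every τ ≥ 0 is reached.
  have hzero : ∀ᵐ ν : ℝ, (fun z => V (z, ν)) =ᵐ[volume] 0 := by
    have hall : ∀ᵐ ν : ℝ, ∀ i : ℕ, ν ≠ 0 →
        ∫ z, V (z, ν) * Complex.exp
          (coherentPhase (TopologicalSpace.denseSeq (Plane n) i) ν 0 (z, 0)) =
        ∫ z, (0 : HeisL2 n) (z, ν) * Complex.exp
          (coherentPhase (TopologicalSpace.denseSeq (Plane n) i) ν 0 (z, 0)) := by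
      refine ae_all_iff.2 fun i => ae_slice_pairing_eq fun g hg hgc hg0 => ?_
      rw [hpair τ hτ V hV _ g hg hgc hg0,
        integral_mul_eq_zero_of_slices U₀ hzero₀ (memLp_wavePacket hg hgc hg0 _ _)]
      refine (integral_eq_zero_of_ae ?_).symm
      exact .of_forall fun p => by simp
    filter_upwards [hall, hne, (Lp.memLp V).prodMk_right_ae,
      ae_ae_swap_of_ae (Lp.coeFn_zero ℂ 2 (volume : Measure (Heis n)))] with ν hν hν0 m hz
    refine ae_eq_zero_of_integral_gaussian_wave m (b := ((Real.pi / 2 * |ν| : ℝ) : ℂ))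
      (by rw [Complex.ofReal_re]; positivity) hDd ?_
    rintro _ ⟨i, rfl⟩
    have h2 := hν i hν0
    simp_rw [coherentPhase_time_zero] at h2
    rw [h2]
    refine integral_eq_zero_of_ae ?_
    filter_upwards [hz] with z hz
    rw [hz]
    simp
  exact Lp_eq_zero_of_integral_partialFourier _ fun a ha hi =>
    (hV a ha hi).trans (integral_mul_eq_zero_of_slices V hzero ha)
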